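/- Let $\Bbbk$ be an algebraically closed field of characteristic $0$, and let $\mathcal{D}$ be the (double of the Jordan plane) unital associative $\Bbbk$-algebra presented by generators $u, v, \zeta, g, g^{-1}, x, y$ and relations $$g g^{-1} = g^{-1} g = 1,\quad \zeta g = g\zeta,\quad gx = xg,\quad gy = yg + xg,\quad \zeta y = y\zeta + y,\quad \zeta x = x\zeta + x,$$ $$ug = gu,\quad vg = gv + gu,\quad v\zeta = \zeta v + v,\quad u\zeta = \zeta u + u,\quad yx = xy - \tfrac12 x^2,\quad vu = uv - \tfrac12 u^2,$$ $$ux = xu,\quad vx = xv + (1-g) + xu,\quad uy = yu + (1-g),\quad vy = yv - g\zeta + yu.$$ For a commutative ring $R$ and $n \ge 0$ let $A_n(R)$ be the Weyl algebra, i.e. the $R$-algebra generated by $p_1,\dots,p_n,q_1,\dots,q_n$ with relations $p_iq_j - q_jp_i = \delta_{ij}$, $p_ip_j = p_jp_i$, $q_iq_j = q_jq_i$. For a (left and right) noetherian domain $A$ let $\operatorname{Frac} A$ be its skew field of fractions (the Ore localization of $A$ at its nonzero elements). For integers $n, s \ge 0$ the Weyl skew field is $\mathscr{D}_{n,s}(\Bbbk)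 := \operatorname{Frac} A_n(\Bbbk(z_1,\dots,z_s))$, where $\Bbbk(z_1,\dots,z_s)$ is the purely transcendental extension of $\Bbbk$ of degree $s$. Then $\mathcal{D}$ and $A_2(\Bbbk(z_1,z_2))$ are noetherian domains, and $\operatorname{Frac}\mathcal{D}$ is isomorphic, as a $\Bbbk$-algebra, to the Weyl skew field $\mathscr{D}_{2,2}(\Bbbk)$. Hence $\mathcal{D}$ satisfies the Gelfand–Kirillov property: it is a noetherian domain whose skew field of fractions is isomorphic as a $\Bbbk$-algebra to $\mathscr{D}_{n,s}(\Bbbk)$ for some integers $n \ge 1$, $s \ge 0$. -/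

import Mathlib

open scoped nonZeroDivisors

/-! ### The double of the Jordan plane -/

/-- The generators `u, v, ζ, g, g⁻¹, x, y` of the double of the Jordan plane. -/
inductive JordanGen : Type
  | u | v | zeta | g | gInv | x | y

namespace JordanGen

/-- The generators as elements of the free `k`-algebra. -/
abbrev X (k : Type*) [Field k] (a : JordanGen) : FreeAlgebra k JordanGen := FreeAlgebra.ι k a

end JordanGen

open JordanGen in
/-- The defining relations of the double of the Jordan plane. -/
inductive JordanDoubleRel (k : Type*) [Field k] :
    FreeAlgebra k JordanGen → FreeAlgebra k JordanGen → Prop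
  | g_gInv : JordanDoubleRel k (X k g * X k gInv) 1
  | gInv_g : JordanDoubleRel k (X k gInv * X k g) 1
  | zeta_g : JordanDoubleRel k (X k zeta * X k g) (X k g * X k zeta)
  | g_x : JordanDoubleRel k (X k g * X k x) (X k x * X k g)
  | g_y : JordanDoubleRel k (X k g * X k y) (X k y * X k g + X k x * X k g)
  | zeta_y : JordanDoubleRel k (X k zeta * X k y) (X k y * X k zeta + X k y)
  | zeta_x : JordanDoubleRel k (X k zeta * X k x) (X k x * X k zeta + X k x)
  | u_g : JordanDoubleRel k (X k u * X k g) (X k g * X k u)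
  | v_g : JordanDoubleRel k (X k v * X k g) (X k g * X k v + X k g * X k u)
  | v_zeta : JordanDoubleRel k (X k v * X k zeta) (X k zeta * X k v + X k v)
  | u_zeta : JordanDoubleRel k (X k u * X k zeta) (X k zeta * X k u + X k u)
  | y_x : JordanDoubleRel k (X k y * X k x) (X k x * X k y - (1 / 2 : k) • X k x ^ 2)
  | v_u : JordanDoubleRel k (X k v * X k u) (X k u * X k v - (1 / 2 : k) • X k u ^ 2)
  | u_x : JordanDoubleRel k (X k u * X k x) (X k x * X k u)
  | v_x : JordanDoubleRel k (X k v * X k x) (X k x * X k v + (1 - X k g) + X k x * X k u)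
  | u_y : JordanDoubleRel k (X k u * X k y) (X k y * X k u + (1 - X k g))
  | v_y : JordanDoubleRel k (X k v * X k y) (X k y * X k v - X k g * X k zeta + X k y * X k u)

/-- The `k`-algebra `𝒟`, the double of the Jordan plane, given by generators and relations. -/
abbrev JordanDouble (k : Type*) [Field k] : Type _ := RingQuot (JordanDoubleRel k)

/-! ### Weyl algebras -/

/-- The generators `p₁, …, pₙ, q₁, …, qₙ` of the `n`-th Weyl algebra. -/
inductive WeylGen (n : ℕ) : Type
  | p (i : Fin n)
  | q (i : Fin n)

/-- The defining relations of the `n`-th Weyl algebra over a commutative ring `R`. -/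
inductive WeylRel (n : ℕ) (R : Type*) [CommRing R] :
    FreeAlgebra R (WeylGen n) → FreeAlgebra R (WeylGen n) → Prop
  | p_q (i : Fin n) : WeylRel n R
      (FreeAlgebra.ι R (.p i) * FreeAlgebra.ι R (.q i) -
        FreeAlgebra.ι R (.q i) * FreeAlgebra.ι R (.p i)) 1
  | p_q_comm (i j : Fin n) (h : i ≠ j) : WeylRel n R
      (FreeAlgebra.ι R (.p i) * FreeAlgebra.ι R (.q j))
      (FreeAlgebra.ι R (.q j) * FreeAlgebra.ι R (.p i))
  | p_p_comm (i j : Fin n) : WeylRel n R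
      (FreeAlgebra.ι R (.p i) * FreeAlgebra.ι R (.p j))
      (FreeAlgebra.ι R (.p j) * FreeAlgebra.ι R (.p i))
  | q_q_comm (i j : Fin n) : WeylRel n R
      (FreeAlgebra.ι R (.q i) * FreeAlgebra.ι R (.q j))
      (FreeAlgebra.ι R (.q j) * FreeAlgebra.ι R (.q i))

/-- The Weyl algebra `Aₙ(R)`. -/
abbrev WeylAlgebra (n : ℕ) (R : Type*) [CommRing R] : Type _ := RingQuot (WeylRel n R)

/-! ### Noetherian domains and their skew fields of fractions -/

/-- A (two-sided) noetherian, not necessarily commutative, domain. -/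
class IsNoetherianDomain (A : Type*) [Ring A] : Prop where
  isDomain : IsDomain A
  left_noetherian : IsNoetherianRing A
  right_noetherian : IsNoetherianRing Aᵐᵒᵖ

attribute [instance] IsNoetherianDomain.isDomain

/-- The left Ore condition in a noetherian domain. -/
theorem IsNoetherianDomain.exists_ore (A : Type*) [Ring A] [h : IsNoetherianDomain A]
    (r : A) (s : A⁰) : ∃ (r' : A) (s' : A⁰), (s' : A) * r = r' * (s : A) := by
  have := h.left_noetherian
  have hs : (s : A) ≠ 0 := nonZeroDivisors.ne_zero s.2
  have hdep : ¬ LinearIndependent A ![r, (s : A)] := by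
    intro hli
    have := hli.fintype_card_le_finrank
    simp at this
  rw [LinearIndependent.pair_iff] at hdep
  push Not at hdep
  obtain ⟨a, b, hab, hne⟩ := hdep
  simp only [smul_eq_mul] at hab
  have ha : a ≠ 0 := by
    intro ha
    rw [ha, zero_mul, zero_add] at hab
    exact hne ha ((mul_eq_zero.mp hab).resolve_right hs)
  refine ⟨-b, ⟨a, mem_nonZeroDivisors_of_ne_zero ha⟩, ?_⟩
  simpa [neg_mul] using eq_neg_of_add_eq_zero_left hab

/-- The nonzero elements of a noetherian domain form an Ore set. -/
noncomputable instance IsNoetherianDomain.oreSet (A : Type*) [Ring A] [IsNoetherianDomain A] :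
    OreLocalization.OreSet A⁰ where
  ore_right_cancel r₁ r₂ s h :=
    ⟨1, by rw [mul_right_cancel₀ (nonZeroDivisors.ne_zero s.2) h]⟩
  oreNum r s := (IsNoetherianDomain.exists_ore A r s).choose
  oreDenom r s := (IsNoetherianDomain.exists_ore A r s).choose_spec.choose
  ore_eq r s := (IsNoetherianDomain.exists_ore A r s).choose_spec.choose_spec

/-- The skew field of fractions `Frac A` of a noetherian domain `A`: the Ore localization of `A` at
its nonzero elements. -/
abbrev SkewFrac (A : Type*) [Ring A] [IsNoetherianDomain A] : Type _ := OreLocalization A⁰ A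

/-! ### Weyl skew fields and the Gelfand–Kirillov property -/

/-- The purely transcendental extension `k(z₁, …, zₛ)`. -/
abbrev RatFuncField (s : ℕ) (k : Type*) [Field k] : Type _ := FractionRing (MvPolynomial (Fin s) k)

/-- The Weyl skew field `𝒟ₙ,ₛ(k) = Frac Aₙ(k(z₁, …, zₛ))`. -/
abbrev WeylSkewField (n s : ℕ) (k : Type*) [Field k]
    [IsNoetherianDomain (WeylAlgebra n (RatFuncField s k))] : Type _ :=
  SkewFrac (WeylAlgebra n (RatFuncField s k))

/-- `A` and `Aₙ(k(z₁, …, zₛ))` are noetherian domains, so that `Frac A` and `𝒟ₙ,ₛ(k)` exist, and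
these two skew fields are isomorphic as `k`-algebras. -/
def FracIsoWeylSkewField (k : Type*) [Field k] (A : Type*) [Ring A] [Algebra k A]
    (n s : ℕ) : Prop :=
  ∃ (_ : IsNoetherianDomain A) (_ : IsNoetherianDomain (WeylAlgebra n (RatFuncField s k))),
    Nonempty (SkewFrac A ≃ₐ[k] WeylSkewField n s k)

/-- The Gelfand–Kirillov property of a `k`-algebra `A`: it is a noetherian domain whose skew field
of fractions is `k`-isomorphic to a Weyl skew field `𝒟ₙ,ₛ(k)` with `n ≥ 1` and `s ≥ 0`. -/
def GelfandKirillovProperty (k : Type*) [Field k] (A : Type*) [Ring A] [Algebra k A] : Prop :=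
  ∃ n s : ℕ, 1 ≤ n ∧ FracIsoWeylSkewField k A n s

/-!
In a Weyl system with pairs `(pᵢ, qᵢ)`, `i = 1, …, 4`, the elements `x = q₁`, `q = q₂`,
`g = q₂² q₃`, `s = q₄`, `ζ = q₁ p₁` and `E = q₁ p₁ + q₂ p₂` are coordinates in terms of which the
generators of the double of the Jordan plane can be written down, so that `𝒟` maps to the skew
field `Frac A₄(k)`. Adjoining the generators in the order `g, g⁻¹, x, u, ζ, y, v`, each of them
can be moved past the subalgebra generated by the previous ones. Hence `𝒟` is noetherian by
Hilbert's basis argument, and its elements are polynomials in the last generator with coefficients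
in the previous ones. Iterated commutators in `Frac A₄(k)` read off leading coefficients, so the
map is injective and `𝒟` is a domain. Its image generates the same skew subfield over `k` as
`p₁, p₂, q₁, q₂, q₃, q₄`. These elements also generate a copy of `A₂(k(z₁, z₂))`, with the central
variables sent to `q₃` and `q₄`, so the two skew fields of fractions are isomorphic.
-/

section RightPolynomials

variable {R B C : Type*} [Ring R] [Ring B] [Ring C]

/-- The additive subgroup of the elements `∑ j < n, t ^ j * i (r j)`: right polynomials in `t` of
degree less than `n`. -/
def rightPolyLT (i : R →+* B) (t : B) : ℕ → AddSubgroup B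
  | 0 => ⊥
  | n + 1 => rightPolyLT i t n ⊔ i.range.toAddSubgroup.map (AddMonoidHom.mulLeft (t ^ n))

variable {i : R →+* B} {t : B}

theorem mem_rightPolyLT_zero {x : B} : x ∈ rightPolyLT i t 0 ↔ x = 0 := by
  simp [rightPolyLT]

theorem mem_rightPolyLT_succ {n : ℕ} {x : B} :
    x ∈ rightPolyLT i t (n + 1) ↔ ∃ f ∈ rightPolyLT i t n, ∃ r, f + t ^ n * i r = x := by
  simp [rightPolyLT, AddSubgroup.mem_sup]

theorem rightPolyLT_mono : Monotone (rightPolyLT i t) :=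
  monotone_nat_of_le_succ fun _ _ h => mem_rightPolyLT_succ.2 ⟨_, h, 0, by simp⟩

theorem map_mem_rightPolyLT_one (r : R) : i r ∈ rightPolyLT i t 1 :=
  mem_rightPolyLT_succ.2 ⟨0, zero_mem _, r, by simp⟩

theorem rightPolyLT_mul_mem {n : ℕ} {x : B} (hx : x ∈ rightPolyLT i t n) (a : R) :
    x * i a ∈ rightPolyLT i t n := by
  induction n generalizing x with
  | zero => simp_all [mem_rightPolyLT_zero]
  | succ n ih =>
    obtain ⟨f, hf, r, rfl⟩ := mem_rightPolyLT_succ.1 hx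
    exact mem_rightPolyLT_succ.2 ⟨f * i a, ih hf, r * a, by simp [add_mul, mul_assoc]⟩

theorem mul_rightPolyLT_mem {n : ℕ} {x : B} (hx : x ∈ rightPolyLT i t n) :
    t * x ∈ rightPolyLT i t (n + 1) := by
  induction n generalizing x with
  | zero => simp_all [mem_rightPolyLT_zero]
  | succ n ih =>
    obtain ⟨f, hf, r, rfl⟩ := mem_rightPolyLT_succ.1 hx
    exact mem_rightPolyLT_succ.2 ⟨t * f, ih hf, r, by simp [mul_add, mul_assoc, pow_succ']⟩

theorem map_mem_rightPolyLT (j : B →+* C) {n : ℕ} {x : B} (hx : x ∈ rightPolyLT i t n) :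
    j x ∈ rightPolyLT (j.comp i) (j t) n := by
  induction n generalizing x with
  | zero => simp_all [mem_rightPolyLT_zero]
  | succ n ih =>
    obtain ⟨f, hf, r, rfl⟩ := mem_rightPolyLT_succ.1 hx
    exact mem_rightPolyLT_succ.2 ⟨j f, ih hf, r, by simp⟩

theorem mem_rightPolyLT_of_map_mem {j : B →+* C} (hj : Function.Injective j) {n : ℕ} {x : B}
    (hx : j x ∈ rightPolyLT (j.comp i) (j t) n) : x ∈ rightPolyLT i t n := by
  induction n generalizing x with
  | zero => simpa [mem_rightPolyLT_zero, map_eq_zero_iff j hj] using hx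
  | succ n ih =>
    obtain ⟨f, hf, r, hr⟩ := mem_rightPolyLT_succ.1 hx
    refine mem_rightPolyLT_succ.2 ⟨x - t ^ n * i r, ih ?_, r, by simp⟩
    convert hf
    simp [← hr]

theorem exists_eq_add_pow_mul {n : ℕ} {x : B} (hx : x ∈ rightPolyLT i t n) (h0 : x ≠ 0) :
    ∃ m, ∃ f ∈ rightPolyLT i t m, ∃ r, i r ≠ 0 ∧ x = f + t ^ m * i r := by
  induction n with
  | zero => exact absurd (mem_rightPolyLT_zero.1 hx) h0
  | succ n ih =>
    obtain ⟨f, hf, r, rfl⟩ := mem_rightPolyLT_succ.1 hx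
    by_cases hr : i r = 0
    · simp_all
    · exact ⟨n, f, hf, r, hr, rfl⟩

/-- Coefficients can be moved past `t` in both directions at the cost of a term of degree `0`:
`B` then behaves like a quotient of a skew polynomial ring in `t` over `R`. -/
structure IsNormalizing (i : R →+* B) (t : B) : Prop where
  left (a : R) : ∃ b c, t * i a = i b * t + i c
  right (a : R) : ∃ b c, i a * t = t * i b + i c

namespace IsNormalizing

theorem exists_mul_pow_eq (ht : IsNormalizing i t) (n : ℕ) (a : R) :
    ∃ b, ∃ f ∈ rightPolyLT i t n, i a * t ^ n = f + t ^ n * i b := by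
  induction n generalizing a with
  | zero => exact ⟨a, 0, zero_mem _, by simp⟩
  | succ n ih =>
    obtain ⟨b, c, hbc⟩ := ht.right a
    obtain ⟨b', f, hf, hb'⟩ := ih b
    obtain ⟨c', f', hf', hc'⟩ := ih c
    refine ⟨b', t * f + (f' + t ^ n * i c'), add_mem (mul_rightPolyLT_mem hf)
      (mem_rightPolyLT_succ.2 ⟨f', hf', c', rfl⟩), ?_⟩
    calc i a * t ^ (n + 1) = t * (i b * t ^ n) + i c * t ^ n := by
          rw [pow_succ', ← mul_assoc, hbc, add_mul, mul_assoc]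
      _ = t * f + (f' + t ^ n * i c') + t ^ (n + 1) * i b' := by
          rw [hb', hc', mul_add, pow_succ', mul_assoc]
          abel

theorem coeff_mul_mem (ht : IsNormalizing i t) {n : ℕ} {x : B} (hx : x ∈ rightPolyLT i t n)
    (a : R) : i a * x ∈ rightPolyLT i t n := by
  induction n generalizing x with
  | zero => simp_all [mem_rightPolyLT_zero]
  | succ n ih =>
    obtain ⟨f, hf, r, rfl⟩ := mem_rightPolyLT_succ.1 hx
    obtain ⟨b, f', hf', hb⟩ := ht.exists_mul_pow_eq n a
    refine mem_rightPolyLT_succ.2 ⟨i a * f + f' * i r, add_mem (ih hf)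
      (rightPolyLT_mul_mem hf' r), b * r, ?_⟩
    rw [mul_add, ← mul_assoc (i a), hb, add_mul, map_mul, mul_assoc (t ^ n), add_assoc]

theorem exists_pow_mul_eq (ht : IsNormalizing i t) (n : ℕ) (a : R) :
    ∃ b, ∃ f ∈ rightPolyLT i t n, i b * t ^ n = f + t ^ n * i a := by
  induction n generalizing a with
  | zero => exact ⟨a, 0, zero_mem _, by simp⟩
  | succ n ih =>
    obtain ⟨b, f, hf, hb⟩ := ih a
    obtain ⟨b', c, hbc⟩ := ht.left b
    obtain ⟨c', f', hf', hc'⟩ := ht.exists_mul_pow_eq n c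
    refine ⟨b', t * f + -(i c * t ^ n), add_mem (mul_rightPolyLT_mem hf)
      (neg_mem (hc' ▸ mem_rightPolyLT_succ.2 ⟨f', hf', c', rfl⟩)), ?_⟩
    calc i b' * t ^ (n + 1) = t * (i b * t ^ n) - i c * t ^ n := by
          rw [pow_succ', ← mul_assoc, ← mul_assoc, hbc, add_mul, add_sub_cancel_right]
      _ = t * f + -(i c * t ^ n) + t ^ (n + 1) * i a := by
          rw [hb, mul_add, pow_succ', mul_assoc]
          abel

/-- The left ideal of the coefficients of `t ^ n` in the elements of `I` of degree at most `n`. -/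
def leadingCoeffIdeal (ht : IsNormalizing i t) (I : Ideal B) (n : ℕ) : Ideal R where
  carrier := {r | ∃ f ∈ rightPolyLT i t n, f + t ^ n * i r ∈ I}
  zero_mem' := ⟨0, zero_mem _, by simp⟩
  add_mem' := by
    rintro r r' ⟨f, hf, hI⟩ ⟨f', hf', hI'⟩
    refine ⟨f + f', add_mem hf hf', ?_⟩
    convert I.add_mem hI hI' using 1
    rw [map_add, mul_add]
    abel
  smul_mem' := by
    rintro a r ⟨f, hf, hI⟩
    obtain ⟨b, f', hf', hb⟩ := ht.exists_pow_mul_eq n a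
    refine ⟨i b * f + f' * i r, add_mem (ht.coeff_mul_mem hf b) (rightPolyLT_mul_mem hf' r), ?_⟩
    convert I.mul_mem_left (i b) hI using 1
    rw [mul_add, ← mul_assoc (i b), hb, add_mul, smul_eq_mul, map_mul, mul_assoc (t ^ n), add_assoc]

theorem leadingCoeffIdeal_mono (ht : IsNormalizing i t) {I J : Ideal B} (hIJ : I ≤ J) {m n : ℕ}
    (hmn : m ≤ n) : ht.leadingCoeffIdeal I m ≤ ht.leadingCoeffIdeal J n := by
  induction n, hmn using Nat.le_induction with
  | base => exact fun r ⟨f, hf, hI⟩ => ⟨f, hf, hIJ hI⟩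
  | succ n _ ih =>
    intro r hr
    obtain ⟨f, hf, hJ⟩ := ih hr
    refine ⟨t * f, mul_rightPolyLT_mem hf, ?_⟩
    convert J.mul_mem_left t hJ using 1
    rw [mul_add, pow_succ', mul_assoc]

theorem le_of_leadingCoeffIdeal_le (ht : IsNormalizing i t)
    (htop : ∀ x, ∃ n, x ∈ rightPolyLT i t n) {I J : Ideal B} (hIJ : I ≤ J)
    (hle : ∀ n, ht.leadingCoeffIdeal J n ≤ ht.leadingCoeffIdeal I n) : J ≤ I := by
  intro x hx
  obtain ⟨n, hn⟩ := htop x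
  induction n generalizing x with
  | zero => simp_all [mem_rightPolyLT_zero]
  | succ n ih =>
    obtain ⟨f, hf, r, rfl⟩ := mem_rightPolyLT_succ.1 hn
    obtain ⟨f', hf', hI⟩ := hle n ⟨f, hf, hx⟩
    have hsub : f - f' ∈ I := by
      refine ih (x := f - f') ?_ (sub_mem hf hf')
      convert J.sub_mem hx (hIJ hI) using 1
      abel
    convert I.add_mem hsub hI using 1
    abel

/-- As in Hilbert's basis theorem, along a chain of ideals the leading coefficient ideals stabilize
in large degrees all at once, by following the diagonal, and then in each smaller degree. -/
theorem isNoetherianRing [IsNoetherianRing R] (ht : IsNormalizing i t)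
    (htop : ∀ x, ∃ n, x ∈ rightPolyLT i t n) : IsNoetherianRing B := by
  rw [isNoetherianRing_iff, ← monotone_stabilizes_iff_noetherian]
  intro f
  have stabilizes : ∀ g : ℕ →o Ideal R, ∃ n, ∀ m, n ≤ m → g n = g m :=
    monotone_stabilizes_iff_noetherian.2 inferInstance
  obtain ⟨N, hN⟩ := stabilizes ⟨fun j => ht.leadingCoeffIdeal (f j) j,
    fun a b hab => ht.leadingCoeffIdeal_mono (f.monotone hab) hab⟩
  choose M hM using fun n => stabilizes ⟨fun j => ht.leadingCoeffIdeal (f j) n,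
    fun a b hab => ht.leadingCoeffIdeal_mono (f.monotone hab) le_rfl⟩
  refine ⟨N ⊔ (Finset.range N).sup M, fun m hm => le_antisymm (f.monotone hm) ?_⟩
  refine ht.le_of_leadingCoeffIdeal_le htop (f.monotone hm) fun n => ?_
  have hNm := le_sup_left.trans hm
  by_cases hn : n < N
  · have hMn : M n ≤ N ⊔ (Finset.range N).sup M :=
      (Finset.le_sup (f := M) (Finset.mem_range.2 hn)).trans le_sup_right
    exact ((hM n _ (hMn.trans hm)).symm.trans (hM n _ hMn)).le
  · rw [not_lt] at hn
    calc ht.leadingCoeffIdeal (f m) n ≤ ht.leadingCoeffIdeal (f (m ⊔ n)) (m ⊔ n) :=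
          ht.leadingCoeffIdeal_mono (f.monotone le_sup_left) le_sup_right
      _ = ht.leadingCoeffIdeal (f N) N := (hN _ (hNm.trans le_sup_left)).symm
      _ ≤ _ := ht.leadingCoeffIdeal_mono (f.monotone le_sup_left) hn

end IsNormalizing

end RightPolynomials

section Commutators

variable {B : Type*} [Ring B] {a b c : B}

theorem lie_mul_right (a b c : B) : ⁅a, b * c⁆ = ⁅a, b⁆ * c + b * ⁅a, c⁆ := by
  simp only [Ring.lie_def]
  noncomm_ring

theorem lie_mul_left (a b c : B) : ⁅a * b, c⁆ = a * ⁅b, c⁆ + ⁅a, c⁆ * b := by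
  simp only [Ring.lie_def]
  noncomm_ring

theorem lie_smul_right {k : Type*} [CommSemiring k] [Algebra k B] (r : k) (a b : B) :
    ⁅a, r • b⁆ = r • ⁅a, b⁆ := by
  simp only [Ring.lie_def, mul_smul_comm, smul_mul_assoc, smul_sub]

theorem mul_left_comm_of_lie_eq (h : ⁅a, b⁆ = c) (d : B) :
    a * (b * d) = b * (a * d) + c * d := by
  rw [← h, Ring.lie_def]
  noncomm_ring

theorem lie_inverse_eq (hab : a * b = 1) (hba : b * a = 1) (t : B) :
    ⁅t, b⁆ = -(b * ⁅t, a⁆ * b) := by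
  rw [Ring.lie_def, Ring.lie_def, mul_sub, sub_mul, ← mul_assoc b a, hba, one_mul, mul_assoc b,
    mul_assoc t, hab, mul_one, neg_sub]

end Commutators

section NormalizingChains

open Algebra

variable {k A : Type*} [CommRing k] [Ring A] [Algebra k A] {s s' : Set A} {t a b : A}

/-- The element `a` can be moved past `t` in both directions, with coefficients in the subalgebra
generated by `s`. -/
structure NormalizesAt (k : Type*) {A : Type*} [CommRing k] [Ring A] [Algebra k A] (s : Set A)
    (t a : A) : Prop where
  left : ∃ b ∈ adjoin k s, ∃ c ∈ adjoin k s, t * a = b * t + c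
  right : ∃ b ∈ adjoin k s, ∃ c ∈ adjoin k s, a * t = t * b + c

namespace NormalizesAt

theorem of_lie_mem (ha : a ∈ adjoin k s) (h : ⁅t, a⁆ ∈ adjoin k s) : NormalizesAt k s t a :=
  ⟨⟨a, ha, _, h, by rw [Ring.lie_def]; abel⟩, ⟨a, ha, _, neg_mem h, by rw [Ring.lie_def]; abel⟩⟩

theorem of_commute (ha : a ∈ adjoin k s) (h : Commute t a) : NormalizesAt k s t a :=
  of_lie_mem ha (h.lie_eq ▸ zero_mem _)

theorem of_lie_eq_smul (ha : a ∈ adjoin k s) (r : k) (h : ⁅t, a⁆ = r • t) :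
    NormalizesAt k s t a := by
  have h' : t * a = a * t + r • t := by rw [← h, Ring.lie_def]; abel
  exact ⟨⟨_, add_mem ha (algebraMap_mem _ r), 0, zero_mem _, by simp [h', add_mul, smul_def]⟩,
    ⟨_, sub_mem ha (algebraMap_mem _ r), 0, zero_mem _, by
      simp [h', mul_sub, ← Algebra.commutes r t, smul_def]⟩⟩

theorem of_lie_inverse_mem (hab : a * b = 1) (hba : b * a = 1) (hb : b ∈ adjoin k s)
    (h : ⁅t, a⁆ ∈ adjoin k s) : NormalizesAt k s t b :=
  of_lie_mem hb (lie_inverse_eq hab hba t ▸ neg_mem (mul_mem (mul_mem hb h) hb))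

theorem mono (hs : s ⊆ s') (h : NormalizesAt k s t a) : NormalizesAt k s' t a := by
  obtain ⟨⟨b, hb, c, hc, e⟩, ⟨b', hb', c', hc', e'⟩⟩ := h
  exact ⟨⟨b, adjoin_mono hs hb, c, adjoin_mono hs hc, e⟩,
    ⟨b', adjoin_mono hs hb', c', adjoin_mono hs hc', e'⟩⟩

theorem algebraMap (r : k) : NormalizesAt k s t (algebraMap k A r) :=
  of_commute (algebraMap_mem _ r) (Algebra.commute_algebraMap_right r t)

theorem add (ha : NormalizesAt k s t a) (hb : NormalizesAt k s t b) :
    NormalizesAt k s t (a + b) := by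
  obtain ⟨⟨a₁, ha₁, c₁, hc₁, e₁⟩, ⟨a₂, ha₂, c₂, hc₂, e₂⟩⟩ := ha
  obtain ⟨⟨b₁, hb₁, d₁, hd₁, f₁⟩, ⟨b₂, hb₂, d₂, hd₂, f₂⟩⟩ := hb
  exact ⟨⟨_, add_mem ha₁ hb₁, _, add_mem hc₁ hd₁, by rw [mul_add, e₁, f₁]; noncomm_ring⟩,
    ⟨_, add_mem ha₂ hb₂, _, add_mem hc₂ hd₂, by rw [add_mul, e₂, f₂]; noncomm_ring⟩⟩

theorem mul (ha : a ∈ adjoin k s) (hb : b ∈ adjoin k s) (hat : NormalizesAt k s t a)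
    (hbt : NormalizesAt k s t b) : NormalizesAt k s t (a * b) := by
  obtain ⟨⟨a₁, ha₁, c₁, hc₁, e₁⟩, ⟨a₂, ha₂, c₂, hc₂, e₂⟩⟩ := hat
  obtain ⟨⟨b₁, hb₁, d₁, hd₁, f₁⟩, ⟨b₂, hb₂, d₂, hd₂, f₂⟩⟩ := hbt
  refine ⟨⟨_, mul_mem ha₁ hb₁, _, add_mem (mul_mem ha₁ hd₁) (mul_mem hc₁ hb), ?_⟩,
    ⟨_, mul_mem ha₂ hb₂, _, add_mem (mul_mem hc₂ hb₂) (mul_mem ha hd₂), ?_⟩⟩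
  · rw [← mul_assoc, e₁, add_mul, mul_assoc a₁, f₁]
    noncomm_ring
  · rw [mul_assoc, f₂, mul_add, ← mul_assoc, e₂]
    noncomm_ring

theorem of_mem_adjoin (h : ∀ a ∈ s, NormalizesAt k s t a) (ha : a ∈ adjoin k s) :
    NormalizesAt k s t a := by
  induction ha using adjoin_induction with
  | mem a ha => exact h a ha
  | algebraMap r => exact .algebraMap r
  | add a b _ _ ha hb => exact ha.add hb
  | mul a b ha hb hat hbt => exact hat.mul ha hb hbt

theorem op (h : NormalizesAt k s t a) :
    NormalizesAt k (MulOpposite.unop ⁻¹' s) (MulOpposite.op t) (MulOpposite.op a) := by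
  obtain ⟨⟨b, hb, c, hc, e⟩, ⟨b', hb', c', hc', e'⟩⟩ := h
  have op_mem : ∀ {x : A}, x ∈ adjoin k s →
      MulOpposite.op x ∈ adjoin k (MulOpposite.unop ⁻¹' s) := fun hx => by
    rwa [← Subalgebra.op_adjoin]
  exact ⟨⟨_, op_mem hb', _, op_mem hc', congrArg MulOpposite.op e'⟩,
    ⟨_, op_mem hb, _, op_mem hc, congrArg MulOpposite.op e⟩⟩

end NormalizesAt

theorem isNormalizing_val_adjoin (h : ∀ a ∈ s, NormalizesAt k s t a) :
    IsNormalizing (adjoin k s).val.toRingHom t where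
  left := fun ⟨_, ha⟩ =>
    have ⟨b, hb, c, hc, e⟩ := (NormalizesAt.of_mem_adjoin h ha).left
    ⟨⟨b, hb⟩, ⟨c, hc⟩, e⟩
  right := fun ⟨_, ha⟩ =>
    have ⟨b, hb, c, hc, e⟩ := (NormalizesAt.of_mem_adjoin h ha).right
    ⟨⟨b, hb⟩, ⟨c, hc⟩, e⟩

theorem exists_mem_rightPolyLT (h : ∀ a ∈ s, NormalizesAt k s t a) {x : A}
    (hx : x ∈ adjoin k (insert t s)) : ∃ n, x ∈ rightPolyLT (adjoin k s).val.toRingHom t n := by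
  have ht := isNormalizing_val_adjoin h
  suffices mul_mem : ∀ n, ∀ f ∈ rightPolyLT (adjoin k s).val.toRingHom t n,
      ∃ m, x * f ∈ rightPolyLT (adjoin k s).val.toRingHom t m by
    simpa using mul_mem 1 1 (map_one (adjoin k s).val.toRingHom ▸ map_mem_rightPolyLT_one 1)
  induction hx using adjoin_induction with
  | mem x hx =>
    intro n f hf
    rcases hx with rfl | hx
    · exact ⟨n + 1, mul_rightPolyLT_mem hf⟩
    · exact ⟨n, ht.coeff_mul_mem hf ⟨x, subset_adjoin hx⟩⟩
  | algebraMap r => exact fun n f hf => ⟨n, ht.coeff_mul_mem hf (algebraMap k _ r)⟩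
  | add x y _ _ hx hy =>
    intro n f hf
    obtain ⟨m, hm⟩ := hx n f hf
    obtain ⟨m', hm'⟩ := hy n f hf
    rw [add_mul]
    exact ⟨m ⊔ m', add_mem (rightPolyLT_mono le_sup_left hm) (rightPolyLT_mono le_sup_right hm')⟩
  | mul x y _ _ hx hy =>
    intro n f hf
    obtain ⟨m, hm⟩ := hy n f hf
    obtain ⟨m', hm'⟩ := hx m _ hm
    exact ⟨m', by rwa [mul_assoc]⟩

theorem isNoetherianRing_adjoin_insert [IsNoetherianRing (adjoin k s)]
    (h : ∀ a ∈ s, NormalizesAt k s t a) : IsNoetherianRing (adjoin k (insert t s)) := by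
  let i : adjoin k s →+* adjoin k (insert t s) :=
    (Subalgebra.inclusion (adjoin_mono (Set.subset_insert t s))).toRingHom
  let t' : adjoin k (insert t s) := ⟨t, subset_adjoin (Set.mem_insert t s)⟩
  have ht := isNormalizing_val_adjoin h
  have ht' : IsNormalizing i t' :=
    ⟨fun a => (ht.left a).imp fun _ ⟨c, e⟩ => ⟨c, Subtype.ext e⟩,
      fun a => (ht.right a).imp fun _ ⟨c, e⟩ => ⟨c, Subtype.ext e⟩⟩
  refine ht'.isNoetherianRing fun x => ?_
  obtain ⟨n, hn⟩ := exists_mem_rightPolyLT h x.2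
  exact ⟨n, mem_rightPolyLT_of_map_mem
    (j := (adjoin k (insert t s)).val.toRingHom) Subtype.val_injective hn⟩

/-- Sets obtained from the empty set by successively inserting elements that normalize the
subalgebra generated by the previous ones. -/
inductive IsNormalizingChain (k : Type*) {A : Type*} [CommRing k] [Ring A] [Algebra k A] :
    Set A → Prop
  | empty : IsNormalizingChain k ∅
  | cons {s : Set A} {t : A} (hs : IsNormalizingChain k s)
      (h : ∀ a ∈ s, NormalizesAt k s t a) : IsNormalizingChain k (insert t s)

namespace IsNormalizingChain

theorem isNoetherianRing_adjoin [IsNoetherianRing k] (hs : IsNormalizingChain k s) :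
    IsNoetherianRing (adjoin k s) := by
  induction hs with
  | empty =>
    rw [adjoin_empty]
    exact isNoetherianRing_of_surjective k _ (algebraMap k (⊥ : Subalgebra k A))
      fun ⟨_, r, hr⟩ => ⟨r, Subtype.ext hr⟩
  | cons _ h ih => exact isNoetherianRing_adjoin_insert h

theorem op (hs : IsNormalizingChain k s) : IsNormalizingChain k (MulOpposite.unop ⁻¹' s) := by
  induction hs with
  | empty => exact .empty
  | @cons s t _ h ih =>
    have preimage_insert : MulOpposite.unop ⁻¹' (insert t s) =
        insert (MulOpposite.op t) (MulOpposite.unop ⁻¹' s) := by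
      ext x
      simp [← MulOpposite.unop_inj]
    rw [preimage_insert]
    exact ih.cons fun a ha => (h _ ha).op

theorem isNoetherianRing [IsNoetherianRing k] (hs : IsNormalizingChain k s)
    (htop : adjoin k s = ⊤) : IsNoetherianRing A := by
  have := hs.isNoetherianRing_adjoin
  rw [htop] at this
  exact isNoetherianRing_of_ringEquiv _ (Subalgebra.topEquiv (R := k) (A := A)).toRingEquiv

theorem isNoetherianDomain [IsNoetherianRing k] [IsDomain A] (hs : IsNormalizingChain k s)
    (htop : adjoin k s = ⊤) : IsNoetherianDomain A where
  isDomain := inferInstance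
  left_noetherian := hs.isNoetherianRing htop
  right_noetherian := hs.op.isNoetherianRing (by rw [← Subalgebra.op_adjoin, htop]; rfl)

end IsNormalizingChain

section Families

variable {ι : Type*} {a : ι → A}

theorem normalizesAt_union_image (h : ∀ i, ∀ b ∈ s, NormalizesAt k s (a i) b)
    (hcomm : ∀ i j, Commute (a i) (a j)) (I : Set ι) (i : ι) :
    ∀ b ∈ s ∪ a '' I, NormalizesAt k (s ∪ a '' I) (a i) b := by
  rintro b (hb | ⟨j, hj, rfl⟩)
  · exact (h i b hb).mono Set.subset_union_left
  · exact .of_commute (subset_adjoin (.inr ⟨j, hj, rfl⟩)) (hcomm i j)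

theorem union_range_induction [Finite ι] {motive : Set A → Prop} (base : motive s)
    (h : ∀ i, ∀ b ∈ s, NormalizesAt k s (a i) b) (hcomm : ∀ i j, Commute (a i) (a j))
    (step : ∀ i, ∀ s' ⊆ s ∪ a '' {i}ᶜ, (∀ b ∈ s', NormalizesAt k s' (a i) b) → motive s' →
      motive (insert (a i) s')) : motive (s ∪ Set.range a) := by
  rw [← Set.image_univ]
  induction Set.univ, Set.finite_univ (α := ι) using Set.Finite.induction_on with
  | empty => simpa
  | @insert i I hi _ ih =>
    rw [Set.image_insert_eq, Set.union_insert]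
    refine step i _ (Set.union_subset_union_right s (Set.image_mono ?_))
      (normalizesAt_union_image h hcomm I i) ih
    exact fun j hj hji => hi (hji ▸ hj)

theorem IsNormalizingChain.union_range [Finite ι] (hs : IsNormalizingChain k s)
    (h : ∀ i, ∀ b ∈ s, NormalizesAt k s (a i) b) (hcomm : ∀ i j, Commute (a i) (a j)) :
    IsNormalizingChain k (s ∪ Set.range a) :=
  union_range_induction hs h hcomm fun _ _ _ hnorm hs' => hs'.cons hnorm

end Families

end NormalizingChains

section IteratedDerivations

open Finset

variable {k T : Type*} [CommRing k] [Ring T] [Algebra k T] {D : Module.End k T}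

theorem pow_apply_mul_of_leibniz (hD : ∀ a b, D (a * b) = D a * b + a * D b) (n : ℕ) (a b : T) :
    (D ^ n) (a * b) = ∑ ij ∈ antidiagonal n, n.choose ij.1 • ((D ^ ij.1) a * (D ^ ij.2) b) := by
  induction n with
  | zero => simp
  | succ n ih =>
    rw [sum_antidiagonal_choose_succ_nsmul (fun i j => (D ^ i) a * (D ^ j) b) n]
    simp only [pow_succ', Module.End.mul_apply, ih, map_sum, map_nsmul, hD, nsmul_add,
      sum_add_distrib]
    rw [add_comm, add_left_cancel_iff]
    refine sum_congr rfl fun ⟨i, j⟩ hij => ?_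
    rw [Nat.choose_symm_of_eq_add (HasAntidiagonal.mem_antidiagonal.1 hij).symm]

/-- The element `a` has degree at most `n` for the derivation `D`, and `α` is the value of `D ^ n`
at `a`, which plays the role of `n!` times its leading coefficient. -/
def HasTopDer (D : Module.End k T) (a : T) (n : ℕ) (α : T) : Prop :=
  (D ^ n) a = α ∧ D α = 0

namespace HasTopDer

variable {a b α β : T} {m n : ℕ}

theorem pow_apply_eq_zero (h : HasTopDer D a n α) (hnm : n < m) : (D ^ m) a = 0 := by
  obtain ⟨j, rfl⟩ := Nat.exists_eq_add_of_lt hnm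
  rw [show n + j + 1 = j + (n + 1) by omega, pow_add, pow_succ', Module.End.mul_apply,
    Module.End.mul_apply, h.1, h.2, map_zero]

theorem mul (hD : ∀ a b, D (a * b) = D a * b + a * D b) (ha : HasTopDer D a n α)
    (hb : HasTopDer D b m β) : HasTopDer D (a * b) (n + m) ((n + m).choose n • (α * β)) := by
  refine ⟨?_, by rw [map_nsmul, hD, ha.2, hb.2]; simp⟩
  rw [pow_apply_mul_of_leibniz hD, sum_eq_single (n, m), ha.1, hb.1]
  · rintro ⟨i, j⟩ hij hne
    rw [HasAntidiagonal.mem_antidiagonal] at hij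
    rcases lt_trichotomy n i with hi | rfl | hi
    · rw [ha.pow_apply_eq_zero hi, zero_mul, smul_zero]
    · obtain rfl : j = m := Nat.add_left_cancel hij
      exact absurd rfl hne
    · rw [hb.pow_apply_eq_zero (show m < j by omega), mul_zero, smul_zero]
  · exact fun h => absurd (HasAntidiagonal.mem_antidiagonal.2 rfl : (n, m) ∈ antidiagonal (n + m)) h

theorem of_apply_eq_zero (h : D a = 0) : HasTopDer D a 0 a := ⟨rfl, h⟩

theorem pow (hD : ∀ a b, D (a * b) = D a * b + a * D b) (h : HasTopDer D a 1 α) (n : ℕ) :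
    HasTopDer D (a ^ n) n (n.factorial • α ^ n) := by
  induction n with
  | zero => simpa using of_apply_eq_zero (D := D) (a := 1) (by simpa using hD 1 1)
  | succ n ih =>
    have hmul := ih.mul hD h
    rwa [smul_mul_assoc, smul_smul, Nat.choose_succ_self_right, ← Nat.factorial_succ, ← pow_succ,
      ← pow_succ] at hmul

end HasTopDer

variable {R : Type*} [Ring R] {i : R →+* T} {t e : T}

theorem HasTopDer.pow_mul (hD : ∀ a b, D (a * b) = D a * b + a * D b) (ht : HasTopDer D t 1 e)
    (n : ℕ) {r : T} (hr : D r = 0) : HasTopDer D (t ^ n * r) n (n.factorial • (e ^ n * r)) := by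
  simpa only [add_zero, Nat.choose_self, one_smul, smul_mul_assoc] using
    (ht.pow hD n).mul hD (.of_apply_eq_zero hr)

theorem pow_apply_eq_zero_of_mem_rightPolyLT (hD : ∀ a b, D (a * b) = D a * b + a * D b)
    (hi : ∀ r, D (i r) = 0) (ht : HasTopDer D t 1 e) {n : ℕ} {x : T}
    (hx : x ∈ rightPolyLT i t n) : (D ^ n) x = 0 := by
  induction n generalizing x with
  | zero => simpa [mem_rightPolyLT_zero] using hx
  | succ n ih =>
    obtain ⟨f, hf, r, rfl⟩ := mem_rightPolyLT_succ.1 hx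
    rw [map_add, (ht.pow_mul hD n (hi r)).pow_apply_eq_zero n.lt_succ_self, pow_succ',
      Module.End.mul_apply, ih hf, map_zero, add_zero]

theorem hasTopDer_add_pow_mul (hD : ∀ a b, D (a * b) = D a * b + a * D b)
    (hi : ∀ r, D (i r) = 0) (ht : HasTopDer D t 1 e) {n : ℕ} {f : T} (hf : f ∈ rightPolyLT i t n)
    (r : R) : HasTopDer D (f + t ^ n * i r) n (n.factorial • (e ^ n * i r)) := by
  have hr := ht.pow_mul hD n (hi r)
  exact ⟨by rw [map_add, pow_apply_eq_zero_of_mem_rightPolyLT hD hi ht hf, zero_add, hr.1], hr.2⟩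

end IteratedDerivations

section DegreeByCommutators

open Algebra

/-- The inner derivation `x ↦ ⁅c, x⁆`. -/
def innerDer (k : Type*) {T : Type*} [CommRing k] [Ring T] [Algebra k T] (c : T) :
    Module.End k T :=
  LinearMap.mulLeft k c - LinearMap.mulRight k c

theorem innerDer_apply {k T : Type*} [CommRing k] [Ring T] [Algebra k T] (c x : T) :
    innerDer k c x = ⁅c, x⁆ := rfl

theorem innerDer_mul {k T : Type*} [CommRing k] [Ring T] [Algebra k T] (c a b : T) :
    innerDer k c (a * b) = innerDer k c a * b + a * innerDer k c b := by
  simp only [innerDer_apply, lie_mul_right]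

variable {k A T : Type*} [Field k] [Ring A] [Algebra k A] [Ring T] [Algebra k T]
  {φ : A →ₐ[k] T} {s : Set A} {t x : A} {c e : T}

theorem lie_map_eq_zero_of_mem_adjoin (hc : ∀ a ∈ s, ⁅c, φ a⁆ = 0) (hx : x ∈ adjoin k s) :
    ⁅c, φ x⁆ = 0 := by
  have hle : adjoin k s ≤ (Subalgebra.centralizer k {c}).comap φ :=
    adjoin_le fun a ha => Set.mem_centralizer_iff.2 <| by simpa using sub_eq_zero.1 (hc a ha)
  exact sub_eq_zero.2 (Set.mem_centralizer_iff.1 (hle hx) c rfl)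

/-- If `⁅c, ·⁆` kills the image of `s` and maps the image of `t` to a constant `e`, then its
iterates read off the leading coefficient of a polynomial in `t`. -/
theorem exists_hasTopDer_of_mem_adjoin_insert (hnorm : ∀ a ∈ s, NormalizesAt k s t a)
    (hcs : ∀ a ∈ s, ⁅c, φ a⁆ = 0) (hct : ⁅c, φ t⁆ = e) (hce : ⁅c, e⁆ = 0)
    (hx : x ∈ adjoin k (insert t s)) (h0 : x ≠ 0) :
    ∃ n, ∃ r ∈ adjoin k s, r ≠ 0 ∧
      HasTopDer (innerDer k c) (φ x) n (n.factorial • (e ^ n * φ r)) := by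
  obtain ⟨N, hN⟩ := exists_mem_rightPolyLT hnorm hx
  obtain ⟨n, f, hf, r, hr, rfl⟩ := exists_eq_add_pow_mul hN h0
  refine ⟨n, r, r.2, hr, ?_⟩
  have htop : HasTopDer (innerDer k c) (φ t) 1 e := ⟨hct, hce⟩
  simpa using hasTopDer_add_pow_mul (innerDer_mul c)
    (i := φ.toRingHom.comp (adjoin k s).val.toRingHom)
    (fun r => lie_map_eq_zero_of_mem_adjoin hcs r.2) htop (map_mem_rightPolyLT φ.toRingHom hf) r

theorem isAddTorsionFree_of_charZero_field (k : Type*) {M : Type*} [Field k] [CharZero k]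
    [AddCommGroup M] [Module k M] : IsAddTorsionFree M :=
  letI := Module.compHom M (algebraMap ℚ k)
  .of_module_rat M

/-- The map `φ` is injective on the subalgebra generated by `s`; stated through the kernel. -/
def InjectiveOnAdjoin (φ : A →ₐ[k] T) (s : Set A) : Prop :=
  ∀ x ∈ adjoin k s, φ x = 0 → x = 0

namespace InjectiveOnAdjoin

theorem empty [Nontrivial T] : InjectiveOnAdjoin φ ∅ := by
  intro x hx h0
  rw [adjoin_empty] at hx
  obtain ⟨r, rfl⟩ := mem_bot.1 hx
  rw [AlgHom.commutes, FaithfulSMul.algebraMap_eq_zero_iff] at h0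
  rw [h0, map_zero]

theorem insert [CharZero k] (hs : InjectiveOnAdjoin φ s)
    (hnorm : ∀ a ∈ s, NormalizesAt k s t a) (hcs : ∀ a ∈ s, ⁅c, φ a⁆ = 0) (hct : ⁅c, φ t⁆ = e)
    (hce : ⁅c, e⁆ = 0) (he : IsUnit e) : InjectiveOnAdjoin φ (insert t s) := by
  intro x hx h0
  have := isAddTorsionFree_of_charZero_field k (M := T)
  by_contra hne
  obtain ⟨n, r, hr, hr0, htop, -⟩ :=
    exists_hasTopDer_of_mem_adjoin_insert hnorm hcs hct hce hx hne
  rw [h0, map_zero, eq_comm, smul_eq_zero_iff_right n.factorial_ne_zero,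
    (he.pow n).mul_right_eq_zero] at htop
  exact hr0 (hs r hr htop)

/-- Denominators can be cleared by powers of `g`. -/
theorem insert_inverse {g : A} (hs : InjectiveOnAdjoin φ s)
    (hnorm : ∀ a ∈ s, NormalizesAt k s t a) (hg : g ∈ adjoin k s) (hgt : g * t = 1)
    (htg : t * g = 1) : InjectiveOnAdjoin φ (Insert.insert t s) := by
  intro x hx h0
  obtain ⟨n, hn⟩ := exists_mem_rightPolyLT hnorm hx
  have pow_mul_mem : ∀ n, ∀ f ∈ rightPolyLT (adjoin k s).val.toRingHom t n,
      g ^ n * f ∈ adjoin k s := by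
    intro n
    induction n with
    | zero => exact fun f hf => by simp [mem_rightPolyLT_zero.1 hf]
    | succ n ih =>
      intro _ h
      obtain ⟨f, hf, r, rfl⟩ := mem_rightPolyLT_succ.1 h
      have expand : g ^ (n + 1) * (f + t ^ n * r) = g * (g ^ n * f) + g * r := by
        rw [mul_add, pow_succ', mul_assoc, mul_assoc, ← mul_assoc (g ^ n), pow_mul_pow_eq_one n hgt,
          one_mul]
      exact expand ▸ add_mem (mul_mem hg (ih f hf)) (mul_mem hg r.2)
  have hgx : g ^ n * x = 0 := hs _ (pow_mul_mem n x hn) (by rw [map_mul, h0, mul_zero])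
  rw [← one_mul x, ← pow_mul_pow_eq_one n htg, mul_assoc, hgx, mul_zero]

theorem injective (hs : InjectiveOnAdjoin φ s) (htop : adjoin k s = ⊤) : Function.Injective φ :=
  (injective_iff_map_eq_zero φ).2 fun x => hs x (htop ▸ mem_top)

end InjectiveOnAdjoin

/-- The map `φ` does not create zero divisors on the subalgebra generated by `s`; so it is injective
there, and this subalgebra has no zero divisors. -/
def ReflectsZeroProducts (φ : A →ₐ[k] T) (s : Set A) : Prop :=
  ∀ x ∈ adjoin k s, ∀ y ∈ adjoin k s, φ x * φ y = 0 → x = 0 ∨ y = 0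

namespace ReflectsZeroProducts

theorem empty [Nontrivial T] : ReflectsZeroProducts φ ∅ := by
  intro x hx y hy h
  rw [adjoin_empty] at hx hy
  obtain ⟨a, rfl⟩ := mem_bot.1 hx
  obtain ⟨b, rfl⟩ := mem_bot.1 hy
  rw [AlgHom.commutes, AlgHom.commutes, ← map_mul, FaithfulSMul.algebraMap_eq_zero_iff,
    mul_eq_zero] at h
  exact h.imp (fun h => by rw [h, map_zero]) fun h => by rw [h, map_zero]

theorem insert [CharZero k] (hs : ReflectsZeroProducts φ s)
    (hnorm : ∀ a ∈ s, NormalizesAt k s t a) (hcs : ∀ a ∈ s, ⁅c, φ a⁆ = 0) (hct : ⁅c, φ t⁆ = 1) :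
    ReflectsZeroProducts φ (insert t s) := by
  intro x hx y hy h
  have := isAddTorsionFree_of_charZero_field k (M := T)
  have hc1 : ⁅c, (1 : T)⁆ = 0 := (Commute.one_right c).lie_eq
  by_contra! hne
  obtain ⟨m, r, hr, hr0, hx⟩ := exists_hasTopDer_of_mem_adjoin_insert hnorm hcs hct hc1 hx hne.1
  obtain ⟨n, r', hr', hr'0, hy⟩ := exists_hasTopDer_of_mem_adjoin_insert hnorm hcs hct hc1 hy hne.2
  have htop := (hx.mul (innerDer_mul c) hy).1
  simp only [h, map_zero, one_pow, one_mul, smul_mul_assoc, mul_smul_comm] at htop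
  rw [eq_comm, smul_eq_zero_iff_right (Nat.choose_pos (Nat.le_add_right m n)).ne',
    smul_eq_zero_iff_right n.factorial_ne_zero,
    smul_eq_zero_iff_right m.factorial_ne_zero] at htop
  exact (hs r hr r' hr' htop).elim hr0 hr'0

theorem union_range [CharZero k] {ι : Type*} [Finite ι] {a : ι → A} {c : ι → T}
    (hs : ReflectsZeroProducts φ s) (hnorm : ∀ i, ∀ b ∈ s, NormalizesAt k s (a i) b)
    (hcomm : ∀ i j, Commute (a i) (a j)) (hcs : ∀ i, ∀ b ∈ s, ⁅c i, φ b⁆ = 0)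
    (hca : ∀ i, ⁅c i, φ (a i)⁆ = 1) (hca' : ∀ i j, i ≠ j → ⁅c i, φ (a j)⁆ = 0) :
    ReflectsZeroProducts φ (s ∪ Set.range a) := by
  refine union_range_induction hs hnorm hcomm fun i s' hs' hnorm' ih =>
    ih.insert hnorm' (c := c i) (fun b hb => ?_) (hca i)
  obtain hb | ⟨j, hj, rfl⟩ := hs' hb
  · exact hcs i b hb
  · exact hca' i j (Ne.symm hj)

theorem injective (hs : ReflectsZeroProducts φ s) (htop : adjoin k s = ⊤) :
    Function.Injective φ := by
  refine (injective_iff_map_eq_zero φ).2 fun x hx => ?_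
  rcases hs x (htop ▸ mem_top) 1 (one_mem _) (by rw [hx, zero_mul]) with h | h
  · exact h
  · rw [← mul_one x, h, mul_zero]

theorem noZeroDivisors (hs : ReflectsZeroProducts φ s) (htop : adjoin k s = ⊤) :
    NoZeroDivisors A where
  eq_zero_or_eq_zero_of_mul_eq_zero {x y} h :=
    hs x (htop ▸ mem_top) y (htop ▸ mem_top) (by rw [← map_mul, h, map_zero])

end ReflectsZeroProducts

end DegreeByCommutators

section SkewFractions

variable {k A B W : Type*} [Field k] [Ring A] [OreLocalization.OreSet A⁰] [Algebra k A] [Ring B]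
  [IsDomain B] [OreLocalization.OreSet B⁰] [Algebra k B] [DivisionRing W] [Algebra k W]

/-- The canonical map from an Ore domain to its skew field of fractions. -/
def toOreFrac (k A : Type*) [Field k] [Ring A] [OreLocalization.OreSet A⁰] [Algebra k A] :
    A →ₐ[k] OreLocalization A⁰ A where
  __ := OreLocalization.numeratorRingHom
  commutes' _ := rfl

theorem toOreFrac_injective : Function.Injective (toOreFrac k A) :=
  OreLocalization.numeratorHom_inj inf_le_left

variable [IsDomain A]

variable (k) in
theorem exists_eq_inv_toOreFrac_mul (x : OreLocalization A⁰ A) :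
     ∃ r s : A, x = (toOreFrac k A s)⁻¹ * toOreFrac k A r := by
  induction x using OreLocalization.ind with
  | _ r s =>
    have hs : toOreFrac k A s ≠ 0 :=
      (map_ne_zero_iff _ toOreFrac_injective).2 (nonZeroDivisors.ne_zero s.2)
    exact ⟨r, s, (eq_inv_mul_iff_mul_eq₀ hs).2 OreLocalization.mul_cancel⟩

/-- The extension of an injective algebra map to the skew field of fractions. -/
noncomputable def oreFracLift (φ : A →ₐ[k] W) (hφ : Function.Injective φ) :
    OreLocalization A⁰ A →ₐ[k] W where
  __ := OreLocalization.universalHom φ.toRingHom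
    (Units.liftRight (φ.toRingHom.toMonoidHom.comp (Submonoid.subtype _))
      (fun s => Units.mk0 (φ s) ((map_ne_zero_iff φ hφ).2 (nonZeroDivisors.ne_zero s.2)))
      fun _ => rfl) fun _ => rfl
  commutes' r := (OreLocalization.universalHom_commutes _ _ _).trans (φ.commutes r)

theorem oreFracLift_toOreFrac (φ : A →ₐ[k] W) (hφ : Function.Injective φ) (a : A) :
    oreFracLift φ hφ (toOreFrac k A a) = φ a :=
  OreLocalization.universalHom_commutes _ _ _

theorem exists_oreFracLift_eq (φ : A →ₐ[k] W) (hφ : Function.Injective φ)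
    (x : OreLocalization A⁰ A) : ∃ r s, oreFracLift φ hφ x = (φ s)⁻¹ * φ r := by
  obtain ⟨r, s, rfl⟩ := exists_eq_inv_toOreFrac_mul k x
  exact ⟨r, s, by rw [map_mul, map_inv₀, oreFracLift_toOreFrac, oreFracLift_toOreFrac]⟩

theorem commute_oreFracLift {φ : A →ₐ[k] W} (hφ : Function.Injective φ) {w : W}
    (hw : ∀ a, Commute (φ a) w) (x : OreLocalization A⁰ A) : Commute (oreFracLift φ hφ x) w := by
  obtain ⟨r, s, hx⟩ := exists_oreFracLift_eq φ hφ x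
  exact hx ▸ (hw s).inv_left₀.mul_left (hw r)

theorem mem_range_oreFracLift (φ : A →ₐ[k] W) (hφ : Function.Injective φ) {w : W} :
    w ∈ (oreFracLift φ hφ).range ↔ w ∈ Subfield.closure (Set.range φ) := by
  constructor
  · rintro ⟨x, rfl⟩
    obtain ⟨r, s, hx⟩ := exists_oreFracLift_eq φ hφ x
    exact hx ▸ mul_mem (inv_mem (Subfield.subset_closure ⟨s, rfl⟩))
      (Subfield.subset_closure ⟨r, rfl⟩)
  · have hle : Subfield.closure (Set.range φ) ≤ (oreFracLift φ hφ).toRingHom.fieldRange :=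
      Subfield.closure_le.2 <| Set.range_subset_iff.2 fun a =>
        ⟨toOreFrac k A a, oreFracLift_toOreFrac φ hφ a⟩
    exact fun hw => hle hw

/-- Two Ore domains that generate the same skew subfield of `W` have isomorphic skew fields of
fractions. -/
noncomputable def oreFracEquivOfClosureEq (φ : A →ₐ[k] W) (ψ : B →ₐ[k] W)
    (hφ : Function.Injective φ) (hψ : Function.Injective ψ)
    (h : Subfield.closure (Set.range φ) = Subfield.closure (Set.range ψ)) :
    OreLocalization A⁰ A ≃ₐ[k] OreLocalization B⁰ B :=
  (AlgEquiv.ofInjective (oreFracLift φ hφ) (oreFracLift φ hφ).toRingHom.injective).trans <|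
    (Subalgebra.equivOfEq _ _ <| SetLike.ext fun _ => by
      rw [mem_range_oreFracLift, h, mem_range_oreFracLift]).trans
    (AlgEquiv.ofInjective (oreFracLift ψ hψ) (oreFracLift ψ hψ).toRingHom.injective).symm

end SkewFractions

section SkewAdjoin

open Algebra

variable {k A V : Type*} [Field k] [Ring A] [DivisionRing V] [Algebra k V]

/-- The division subalgebra of `V` over `k` generated by `s`. -/
def skewAdjoin (k : Type*) {V : Type*} [Field k] [DivisionRing V] [Algebra k V] (s : Set V) :
    Subfield V :=
  Subfield.closure (Set.range (algebraMap k V) ∪ s)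

variable {s s' : Set V}

theorem subset_skewAdjoin : s ⊆ skewAdjoin k s :=
  fun _ ha => Subfield.subset_closure (.inr ha)

theorem algebraMap_mem_skewAdjoin (r : k) : algebraMap k V r ∈ skewAdjoin k s :=
  Subfield.subset_closure (.inl ⟨r, rfl⟩)

theorem smul_mem_skewAdjoin (r : k) {a : V} (ha : a ∈ skewAdjoin k s) : r • a ∈ skewAdjoin k s := by
  rw [Algebra.smul_def]
  exact mul_mem (algebraMap_mem_skewAdjoin r) ha

theorem skewAdjoin_le (h : s ⊆ skewAdjoin k s') : skewAdjoin k s ≤ skewAdjoin k s' :=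
  Subfield.closure_le.2 <| Set.union_subset
    (Set.range_subset_iff.2 algebraMap_mem_skewAdjoin) h

theorem closure_range_le_skewAdjoin {R : Type*} [CommRing R] [Algebra R A] {t : Set A}
    (φ : A →+* V) (ht : adjoin R t = ⊤) (hR : ∀ r, φ (algebraMap R A r) ∈ skewAdjoin k s)
    (hs : ∀ a ∈ t, φ a ∈ skewAdjoin k s) : Subfield.closure (Set.range φ) ≤ skewAdjoin k s := by
  refine Subfield.closure_le.2 <| Set.range_subset_iff.2 fun a => ?_
  have ha : a ∈ adjoin R t := ht ▸ mem_top
  induction ha using adjoin_induction with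
  | mem a ha => exact hs a ha
  | algebraMap r => exact hR r
  | add a b _ _ ha hb => exact map_add φ a b ▸ add_mem ha hb
  | mul a b _ _ ha hb => exact map_mul φ a b ▸ mul_mem ha hb

variable [Algebra k A]

theorem skewAdjoin_le_closure_range (φ : A →ₐ[k] V) (hs : s ⊆ Subfield.closure (Set.range φ)) :
    skewAdjoin k s ≤ Subfield.closure (Set.range φ) :=
  Subfield.closure_le.2 <| Set.union_subset
    (Set.range_subset_iff.2 fun r => Subfield.subset_closure ⟨algebraMap k A r, φ.commutes r⟩) hs

theorem closure_range_eq_skewAdjoin_image (φ : A →ₐ[k] V) {t : Set A} (ht : adjoin k t = ⊤) :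
    Subfield.closure (Set.range φ) = skewAdjoin k (φ '' t) :=
  le_antisymm
    (closure_range_le_skewAdjoin (R := k) φ.toRingHom ht
      (fun r => (φ.commutes r).symm ▸ algebraMap_mem_skewAdjoin r)
      fun a ha => subset_skewAdjoin ⟨a, ha, rfl⟩)
    (skewAdjoin_le_closure_range φ <| Set.image_subset_iff.2 fun a _ =>
      Subfield.subset_closure ⟨a, rfl⟩)

end SkewAdjoin

section PresentedAlgebras

open Algebra

variable {R X B : Type*} [CommRing R] [Ring B] [Algebra R B]
  {r : FreeAlgebra R X → FreeAlgebra R X → Prop}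

/-- The generator `x` of the algebra presented by the relations `r`. -/
noncomputable def presentedGen (r : FreeAlgebra R X → FreeAlgebra R X → Prop) (x : X) :
    RingQuot r :=
  RingQuot.mkAlgHom R r (FreeAlgebra.ι R x)

theorem lift_presentedGen_eq {a b : FreeAlgebra R X} (h : r a b) :
    FreeAlgebra.lift R (presentedGen r) a = FreeAlgebra.lift R (presentedGen r) b := by
  have lift_eq : FreeAlgebra.lift R (presentedGen r) = RingQuot.mkAlgHom R r := by
    ext x
    simp [presentedGen]
  rw [lift_eq, RingQuot.mkAlgHom_rel R h]

theorem adjoin_range_presentedGen : adjoin R (Set.range (presentedGen r)) = ⊤ := by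
  have range_eq :
      Set.range (presentedGen r) = RingQuot.mkAlgHom R r '' Set.range (FreeAlgebra.ι R) :=
    Set.range_comp _ _
  rw [range_eq, ← AlgHom.map_adjoin, FreeAlgebra.adjoin_range_ι, Algebra.map_top,
    AlgHom.range_eq_top]
  exact RingQuot.mkAlgHom_surjective R r

/-- The algebra map out of a presented algebra given by elements that satisfy the relations. -/
noncomputable def presentedLift (f : X → B)
    (hf : ∀ ⦃a b⦄, r a b → FreeAlgebra.lift R f a = FreeAlgebra.lift R f b) : RingQuot r →ₐ[R] B :=
  RingQuot.liftAlgHom R ⟨FreeAlgebra.lift R f, hf⟩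

@[simp]
theorem presentedLift_presentedGen (f : X → B)
    (hf : ∀ ⦃a b⦄, r a b → FreeAlgebra.lift R f a = FreeAlgebra.lift R f b) (x : X) :
    presentedLift f hf (presentedGen r x) = f x := by
  simp [presentedLift, presentedGen]

end PresentedAlgebras

section WeylSystems

open Algebra

/-- Families `P`, `Q` of elements of a ring that satisfy the canonical commutation relations. -/
structure IsWeylSystem {ι W : Type*} [Ring W] (P Q : ι → W) : Prop where
  lie_self (i : ι) : ⁅P i, Q i⁆ = 1
  commute_of_ne {i j : ι} : i ≠ j → Commute (P i) (Q j)
  commute_p (i j : ι) : Commute (P i) (P j)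
  commute_q (i j : ι) : Commute (Q i) (Q j)

namespace IsWeylSystem

variable {k ι κ A T : Type*} [Field k] [Ring A] [Algebra k A] [Ring T] [Algebra k T]
  {P Q : ι → A}

theorem q_ne_zero [Nontrivial A] (h : IsWeylSystem P Q) (i : ι) : Q i ≠ 0 := by
  intro h0
  simpa [h0, Ring.lie_def] using h.lie_self i

theorem lie_p_q [DecidableEq ι] (h : IsWeylSystem P Q) (i j : ι) :
    ⁅P i, Q j⁆ = if i = j then 1 else 0 := by
  split_ifs with hij
  · exact hij ▸ h.lie_self i
  · exact (h.commute_of_ne hij).lie_eq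

theorem lie_q_q (h : IsWeylSystem P Q) (i j : ι) : ⁅Q i, Q j⁆ = 0 :=
  (h.commute_q i j).lie_eq

theorem lie_p_p (h : IsWeylSystem P Q) (i j : ι) : ⁅P i, P j⁆ = 0 :=
  (h.commute_p i j).lie_eq

theorem lie_inv_q_q {V : Type*} [DivisionRing V] {P Q : ι → V} (h : IsWeylSystem P Q) (i j : ι) :
    ⁅(Q i)⁻¹, Q j⁆ = 0 :=
  (h.commute_q i j).inv_left₀.lie_eq

theorem comp (h : IsWeylSystem P Q) {f : κ → ι} (hf : Function.Injective f) :
    IsWeylSystem (P ∘ f) (Q ∘ f) where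
  lie_self i := h.lie_self (f i)
  commute_of_ne hij := h.commute_of_ne (hf.ne hij)
  commute_p _ _ := h.commute_p _ _
  commute_q _ _ := h.commute_q _ _

theorem map (h : IsWeylSystem P Q) (φ : A →ₐ[k] T) : IsWeylSystem (φ ∘ P) (φ ∘ Q) where
  lie_self i := by simpa [Ring.lie_def] using congrArg φ (h.lie_self i)
  commute_of_ne hij := (h.commute_of_ne hij).map φ
  commute_p i j := (h.commute_p i j).map φ
  commute_q i j := (h.commute_q i j).map φ

theorem of_injective {φ : A →ₐ[k] T} (hφ : Function.Injective φ)
    (h : IsWeylSystem (φ ∘ P) (φ ∘ Q)) : IsWeylSystem P Q where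
  lie_self i := hφ (by simpa [Ring.lie_def] using h.lie_self i)
  commute_of_ne hij := (h.commute_of_ne hij).of_map hφ
  commute_p i j := (h.commute_p i j).of_map hφ
  commute_q i j := (h.commute_q i j).of_map hφ

theorem normalizesAt_p (h : IsWeylSystem P Q) (i : ι) :
    ∀ b ∈ Set.range Q, NormalizesAt k (Set.range Q) (P i) b := by
  rintro _ ⟨j, rfl⟩
  obtain rfl | hij := eq_or_ne i j
  · exact .of_lie_mem (subset_adjoin ⟨i, rfl⟩) (h.lie_self i ▸ one_mem _)
  · exact .of_commute (subset_adjoin ⟨j, rfl⟩) (h.commute_of_ne hij)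

theorem isNormalizingChain [Finite ι] (h : IsWeylSystem P Q) :
    IsNormalizingChain k (Set.range Q ∪ Set.range P) := by
  refine .union_range ?_ h.normalizesAt_p h.commute_p
  simpa using IsNormalizingChain.union_range (k := k) .empty (by simp) h.commute_q

theorem reflectsZeroProducts [CharZero k] [Nontrivial T] [Finite ι] (h : IsWeylSystem P Q)
    (φ : A →ₐ[k] T) : ReflectsZeroProducts φ (Set.range Q ∪ Set.range P) := by
  have hφ := h.map φ
  refine .union_range (c := fun i => -φ (Q i)) ?_ h.normalizesAt_p h.commute_p ?_ ?_ ?_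
  · simpa using ReflectsZeroProducts.union_range (c := fun i => φ (P i)) .empty (by simp)
      h.commute_q (by simp) hφ.lie_self fun i j hij => (hφ.commute_of_ne hij).lie_eq
  · rintro i _ ⟨j, rfl⟩
    exact ((hφ.commute_q i j).neg_left).lie_eq
  · intro i
    rw [Ring.lie_def, neg_mul, mul_neg, sub_neg_eq_add, neg_add_eq_sub]
    exact hφ.lie_self i
  · exact fun i j hij => ((hφ.commute_of_ne hij.symm).symm.neg_left).lie_eq

end IsWeylSystem

end WeylSystems

section WeylAlgebras

open Algebra

variable {n : ℕ} {R W : Type*} [CommRing R] [Ring W] [Algebra R W] {P Q : Fin n → W}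

theorem isWeylSystem_presentedGen : IsWeylSystem
    (fun i : Fin n => presentedGen (WeylRel n R) (.p i))
    (fun i => presentedGen (WeylRel n R) (.q i)) where
  lie_self i := by simpa [Ring.lie_def] using lift_presentedGen_eq (WeylRel.p_q (R := R) i)
  commute_of_ne {i j} hij := by
    simpa [commute_iff_eq] using lift_presentedGen_eq (WeylRel.p_q_comm (R := R) i j hij)
  commute_p i j := by
    simpa [commute_iff_eq] using lift_presentedGen_eq (WeylRel.p_p_comm (R := R) i j)
  commute_q i j := by
    simpa [commute_iff_eq] using lift_presentedGen_eq (WeylRel.q_q_comm (R := R) i j)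

theorem range_eq_range_q_union_range_p {M : Type*} (f : WeylGen n → M) :
    Set.range f = (Set.range fun i => f (.q i)) ∪ Set.range fun i => f (.p i) := by
  ext x
  constructor
  · rintro ⟨i | i, rfl⟩
    exacts [.inr ⟨i, rfl⟩, .inl ⟨i, rfl⟩]
  · rintro (⟨i, rfl⟩ | ⟨i, rfl⟩) <;> exact ⟨_, rfl⟩

theorem adjoin_presentedGen_q_union_p :
    adjoin R ((Set.range fun i : Fin n => presentedGen (WeylRel n R) (.q i)) ∪
      Set.range fun i => presentedGen (WeylRel n R) (.p i)) = ⊤ := by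
  rw [← range_eq_range_q_union_range_p, adjoin_range_presentedGen]

/-- The representation of the Weyl algebra given by a Weyl system. -/
noncomputable def weylLift (R : Type*) [CommRing R] [Algebra R W] (h : IsWeylSystem P Q) :
    WeylAlgebra n R →ₐ[R] W :=
  presentedLift (fun | .p i => P i | .q i => Q i) fun a b hab => by
    cases hab with
    | p_q i => simpa [Ring.lie_def] using h.lie_self i
    | p_q_comm i j hij => simpa using (h.commute_of_ne hij).eq
    | p_p_comm i j => simpa using (h.commute_p i j).eq
    | q_q_comm i j => simpa using (h.commute_q i j).eq

@[simp]
theorem weylLift_p (h : IsWeylSystem P Q) (i : Fin n) :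
    weylLift R h (presentedGen _ (.p i)) = P i :=
  presentedLift_presentedGen _ _ _

@[simp]
theorem weylLift_q (h : IsWeylSystem P Q) (i : Fin n) :
    weylLift R h (presentedGen _ (.q i)) = Q i :=
  presentedLift_presentedGen _ _ _

theorem isWeylSystem_pderiv (R ι : Type*) [CommRing R] : IsWeylSystem
    (fun i : ι => (MvPolynomial.pderiv (R := R) i : Module.End R (MvPolynomial ι R)))
    (fun i => LinearMap.mulLeft R (MvPolynomial.X i)) where
  lie_self i := LinearMap.ext fun f => by simp [Ring.lie_def]
  commute_of_ne hij := LinearMap.ext fun f => by simp [MvPolynomial.pderiv_X_of_ne hij.symm]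
  commute_p i j := LinearMap.ext fun f => by
    have lie_eq_zero : ⁅MvPolynomial.pderiv (R := R) i, MvPolynomial.pderiv (R := R) j⁆ = 0 := by
      classical
      refine MvPolynomial.derivation_ext fun l => ?_
      rw [Derivation.commutator_apply]
      simp [MvPolynomial.pderiv_X, Pi.single_apply, apply_ite]
    have := DFunLike.congr_fun lie_eq_zero f
    rw [Derivation.commutator_apply] at this
    exact sub_eq_zero.1 this
  commute_q i j := LinearMap.ext fun f => mul_left_comm _ _ f

variable {k : Type*} [Field k] [CharZero k] [Algebra k W]

theorem weylLift_injective [Nontrivial W] (h : IsWeylSystem P Q) :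
    Function.Injective (weylLift k h) :=
  (isWeylSystem_presentedGen.reflectsZeroProducts _).injective adjoin_presentedGen_q_union_p

instance isNoetherianDomain_weylAlgebra (n : ℕ) : IsNoetherianDomain (WeylAlgebra n k) :=
  have φ := weylLift k (isWeylSystem_pderiv k (Fin n))
  have := φ.toRingHom.domain_nontrivial
  have := (isWeylSystem_presentedGen.reflectsZeroProducts φ).noZeroDivisors
    adjoin_presentedGen_q_union_p
  have := NoZeroDivisors.to_isDomain (WeylAlgebra n k)
  isWeylSystem_presentedGen.isNormalizingChain.isNoetherianDomain adjoin_presentedGen_q_union_p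

end WeylAlgebras

section WeylSubfields

open Algebra

variable {k : Type*} [Field k]

section Extension

variable {n : ℕ} {K V : Type*} [Field K] [Algebra k K] [Ring V] [Algebra k V] {P Q : Fin n → V}

theorem exists_weylAlgHom_of_commute [CharZero K] [Nontrivial V] (ρ : K →ₐ[k] V)
    (h : IsWeylSystem P Q) (hP : ∀ c i, Commute (ρ c) (P i)) (hQ : ∀ c i, Commute (ρ c) (Q i)) :
    ∃ ψ : WeylAlgebra n K →ₐ[k] V, Function.Injective ψ ∧ (∀ c, ψ (algebraMap K _ c) = ρ c) ∧
      (∀ i, ψ (presentedGen _ (.p i)) = P i) ∧ ∀ i, ψ (presentedGen _ (.q i)) = Q i := by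
  let B := Subalgebra.centralizer k (Set.range ρ)
  have mem_B {w : V} (hw : ∀ c, Commute (ρ c) w) : w ∈ B :=
    Set.mem_centralizer_iff.2 <| Set.forall_mem_range.2 hw
  let ρ' : K →ₐ[k] B := ρ.codRestrict B fun c => mem_B fun c' => (Commute.all c' c).map ρ
  let : Algebra K B := ρ'.toRingHom.toAlgebra' fun c w => Subtype.ext (w.2 _ ⟨c, rfl⟩)
  have : IsScalarTower k K B := .of_algebraMap_eq fun r => (ρ'.commutes r).symm
  have hB : IsWeylSystem (fun i => ⟨P i, mem_B (hP · i)⟩ : Fin n → B)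
      fun i => ⟨Q i, mem_B (hQ · i)⟩ := .of_injective (φ := B.val) Subtype.val_injective h
  refine ⟨B.val.comp ((weylLift K hB).restrictScalars k), ?_, fun c => ?_, fun i => ?_, fun i => ?_⟩
  · exact Subtype.val_injective.comp (weylLift_injective hB)
  · exact congrArg Subtype.val ((weylLift K hB).commutes c)
  · exact congrArg Subtype.val (weylLift_p hB i)
  · exact congrArg Subtype.val (weylLift_q hB i)

end Extension

section Polynomials

open MvPolynomial

variable {ι V : Type*} [Ring V] [Algebra k V] {P Q : ι → V}

open scoped IsMulCommutative in
theorem exists_mvPolynomial_algHom (hQ : ∀ i j, Commute (Q i) (Q j)) :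
    ∃ f : MvPolynomial ι k →ₐ[k] V, ∀ i, f (X i) = Q i := by
  have := isMulCommutative_adjoin k (s := Set.range Q) (by
    rintro _ ⟨i, rfl⟩ _ ⟨j, rfl⟩
    exact hQ i j)
  let q (i : ι) : adjoin k (Set.range Q) := ⟨Q i, subset_adjoin ⟨i, rfl⟩⟩
  exact ⟨(adjoin k (Set.range Q)).val.comp (aeval (R := k) q), by simp [q]⟩

variable {f : MvPolynomial ι k →ₐ[k] V}

theorem IsWeylSystem.injective_of_map_X [CharZero k] [Finite ι] [Nontrivial V]
    (h : IsWeylSystem P Q) (hf : ∀ i, f (X i) = Q i) : Function.Injective f := by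
  refine ReflectsZeroProducts.injective (s := ∅ ∪ Set.range X) ?_ (by simp [adjoin_range_X])
  refine .union_range (c := P) .empty (by simp) (fun i j => Commute.all _ _) (by simp) ?_ ?_
  · exact fun i => hf i ▸ h.lie_self i
  · exact fun i j hij => hf j ▸ (h.commute_of_ne hij).lie_eq

theorem commute_map_of_commute_map_X (hf : ∀ i, f (X i) = Q i) {w : V} (hw : ∀ i, Commute (Q i) w)
    (p : MvPolynomial ι k) : Commute (f p) w := by
  have hp : p ∈ adjoin k (Set.range X) := by simp [adjoin_range_X]
  refine (sub_eq_zero.1 (lie_map_eq_zero_of_mem_adjoin (φ := f) (c := w) ?_ hp)).symm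
  rintro _ ⟨i, rfl⟩
  exact hf i ▸ (hw i).symm.lie_eq

end Polynomials

/-- The last `s` variables `Q (.inr j)` of a Weyl system generate a rational function field over
which the first `n` pairs are a Weyl system. -/
theorem exists_weylAlgHom_ratFunc [CharZero k] {V : Type*} [DivisionRing V] [Algebra k V]
    {n s : ℕ} {P Q : Fin n ⊕ Fin s → V} (h : IsWeylSystem P Q) :
    ∃ ψ : WeylAlgebra n (RatFuncField s k) →ₐ[k] V, Function.Injective ψ ∧
      Subfield.closure (Set.range ψ) = skewAdjoin k (Set.range (P ∘ Sum.inl) ∪ Set.range Q) := by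
  obtain ⟨f, hf⟩ := exists_mvPolynomial_algHom (k := k) (h.comp Sum.inr_injective).commute_q
  have hinj := (h.comp Sum.inr_injective).injective_of_map_X hf
  have commute_ratFunc {w : V} (hw : ∀ j, Commute (Q (.inr j)) w) (c : RatFuncField s k) :
      Commute (oreFracLift f hinj c) w :=
    commute_oreFracLift hinj (commute_map_of_commute_map_X hf hw) c
  obtain ⟨ψ, hψ, hc, hp, hq⟩ := exists_weylAlgHom_of_commute (oreFracLift f hinj)
    (h.comp Sum.inl_injective)
    (fun c i => commute_ratFunc (fun j => (h.commute_of_ne Sum.inl_ne_inr).symm) c)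
    (fun c i => commute_ratFunc (fun j => h.commute_q _ _) c)
  refine ⟨ψ, hψ, le_antisymm ?_ (skewAdjoin_le_closure_range ψ ?_)⟩
  · have map_poly_mem (p : MvPolynomial (Fin s) k) :
        f p ∈ skewAdjoin k (Set.range (P ∘ Sum.inl) ∪ Set.range Q) := by
      refine closure_range_le_skewAdjoin f.toRingHom (MvPolynomial.adjoin_range_X (R := k))
        (fun r => ?_) ?_ (Subfield.subset_closure ⟨p, rfl⟩)
      · exact (f.commutes r).symm ▸ algebraMap_mem_skewAdjoin r
      · rintro _ ⟨j, rfl⟩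
        exact (hf j).symm ▸ subset_skewAdjoin (.inr ⟨_, rfl⟩)
    refine closure_range_le_skewAdjoin ψ.toRingHom adjoin_range_presentedGen (fun c => ?_) ?_
    · obtain ⟨r, s, h⟩ := exists_oreFracLift_eq f hinj c
      exact ((hc c).trans h).symm ▸ mul_mem (inv_mem (map_poly_mem s)) (map_poly_mem r)
    · rintro _ ⟨i | i, rfl⟩
      · exact (hp i).symm ▸ subset_skewAdjoin (.inl ⟨i, rfl⟩)
      · exact (hq i).symm ▸ subset_skewAdjoin (.inr ⟨_, rfl⟩)
  · rintro _ (⟨i, rfl⟩ | ⟨i | j, rfl⟩) <;> refine Subfield.subset_closure ?_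
    · exact ⟨_, hp i⟩
    · exact ⟨_, hq i⟩
    · exact ⟨_, (hc _).trans ((oreFracLift_toOreFrac f hinj (MvPolynomial.X j)).trans (hf j))⟩

end WeylSubfields

section JordanDouble

open Algebra JordanGen

variable {k : Type*} [Field k]

/-- The generator `a` of the double of the Jordan plane. -/
noncomputable abbrev jordanGen (k : Type*) [Field k] (a : JordanGen) : JordanDouble k :=
  presentedGen (JordanDoubleRel k) a

namespace jordanGen

theorem g_mul_gInv : jordanGen k g * jordanGen k gInv = 1 := by
  simpa using lift_presentedGen_eq (JordanDoubleRel.g_gInv (k := k))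

theorem gInv_mul_g : jordanGen k gInv * jordanGen k g = 1 := by
  simpa using lift_presentedGen_eq (JordanDoubleRel.gInv_g (k := k))

theorem commute_x_g : Commute (jordanGen k x) (jordanGen k g) := by
  simpa [commute_iff_eq, eq_comm] using lift_presentedGen_eq (JordanDoubleRel.g_x (k := k))

theorem commute_u_g : Commute (jordanGen k u) (jordanGen k g) := by
  simpa [commute_iff_eq] using lift_presentedGen_eq (JordanDoubleRel.u_g (k := k))

theorem commute_u_x : Commute (jordanGen k u) (jordanGen k x) := by
  simpa [commute_iff_eq] using lift_presentedGen_eq (JordanDoubleRel.u_x (k := k))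

theorem commute_zeta_g : Commute (jordanGen k zeta) (jordanGen k g) := by
  simpa [commute_iff_eq] using lift_presentedGen_eq (JordanDoubleRel.zeta_g (k := k))

theorem lie_zeta_x : ⁅jordanGen k zeta, jordanGen k x⁆ = jordanGen k x := by
  have h := lift_presentedGen_eq (JordanDoubleRel.zeta_x (k := k))
  simp only [map_mul, map_add, FreeAlgebra.lift_ι_apply] at h
  rw [Ring.lie_def, h]
  abel

theorem lie_zeta_u : ⁅jordanGen k zeta, jordanGen k u⁆ = -jordanGen k u := by
  have h := lift_presentedGen_eq (JordanDoubleRel.u_zeta (k := k))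
  simp only [map_mul, map_add, FreeAlgebra.lift_ι_apply] at h
  rw [Ring.lie_def, h]
  abel

theorem lie_y_g : ⁅jordanGen k y, jordanGen k g⁆ = -(jordanGen k x * jordanGen k g) := by
  have h := lift_presentedGen_eq (JordanDoubleRel.g_y (k := k))
  simp only [map_mul, map_add, FreeAlgebra.lift_ι_apply] at h
  rw [Ring.lie_def, h]
  abel

theorem lie_y_x : ⁅jordanGen k y, jordanGen k x⁆ = -((1 / 2 : k) • jordanGen k x ^ 2) := by
  have h := lift_presentedGen_eq (JordanDoubleRel.y_x (k := k))
  simp only [map_mul, map_sub, map_smul, map_pow, FreeAlgebra.lift_ι_apply] at h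
  rw [Ring.lie_def, h]
  abel

theorem lie_y_u : ⁅jordanGen k y, jordanGen k u⁆ = jordanGen k g - 1 := by
  have h := lift_presentedGen_eq (JordanDoubleRel.u_y (k := k))
  simp only [map_mul, map_add, map_sub, map_one, FreeAlgebra.lift_ι_apply] at h
  rw [Ring.lie_def, h]
  abel

theorem lie_y_zeta : ⁅jordanGen k y, jordanGen k zeta⁆ = -jordanGen k y := by
  have h := lift_presentedGen_eq (JordanDoubleRel.zeta_y (k := k))
  simp only [map_mul, map_add, FreeAlgebra.lift_ι_apply] at h
  rw [Ring.lie_def, h]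
  abel

theorem lie_v_g : ⁅jordanGen k v, jordanGen k g⁆ = jordanGen k g * jordanGen k u := by
  have h := lift_presentedGen_eq (JordanDoubleRel.v_g (k := k))
  simp only [map_mul, map_add, FreeAlgebra.lift_ι_apply] at h
  rw [Ring.lie_def, h]
  abel

theorem lie_v_x : ⁅jordanGen k v, jordanGen k x⁆ =
    1 - jordanGen k g + jordanGen k x * jordanGen k u := by
  have h := lift_presentedGen_eq (JordanDoubleRel.v_x (k := k))
  simp only [map_mul, map_add, map_sub, map_one, FreeAlgebra.lift_ι_apply] at h
  rw [Ring.lie_def, h]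
  abel

theorem lie_v_u : ⁅jordanGen k v, jordanGen k u⁆ = -((1 / 2 : k) • jordanGen k u ^ 2) := by
  have h := lift_presentedGen_eq (JordanDoubleRel.v_u (k := k))
  simp only [map_mul, map_sub, map_smul, map_pow, FreeAlgebra.lift_ι_apply] at h
  rw [Ring.lie_def, h]
  abel

theorem lie_v_zeta : ⁅jordanGen k v, jordanGen k zeta⁆ = jordanGen k v := by
  have h := lift_presentedGen_eq (JordanDoubleRel.v_zeta (k := k))
  simp only [map_mul, map_add, FreeAlgebra.lift_ι_apply] at h
  rw [Ring.lie_def, h]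
  abel

theorem lie_v_y : ⁅jordanGen k v, jordanGen k y⁆ =
    jordanGen k y * jordanGen k u - jordanGen k g * jordanGen k zeta := by
  have h := lift_presentedGen_eq (JordanDoubleRel.v_y (k := k))
  simp only [map_mul, map_add, map_sub, FreeAlgebra.lift_ι_apply] at h
  rw [Ring.lie_def, h]
  abel

/-- The generator `t` normalizes the subalgebra generated by the generators in `S`. -/
def Normalizes (k : Type*) [Field k] (S : Set JordanGen) (t : JordanGen) : Prop :=
  ∀ a ∈ jordanGen k '' S, NormalizesAt k (jordanGen k '' S) (jordanGen k t) a

section Chain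

variable {S : Set JordanGen} {a t : JordanGen}

theorem mem_adjoin (ha : a ∈ S) : jordanGen k a ∈ adjoin k (jordanGen k '' S) :=
  subset_adjoin (Set.mem_image_of_mem _ ha)

theorem normalizes_of_lie_mem (hg : g ∈ S)
    (hzeta : zeta ∈ S → ∃ r : k, ⁅jordanGen k t, jordanGen k zeta⁆ = r • jordanGen k t)
    (h : ∀ a ∈ S, a ≠ zeta → a ≠ gInv →
      ⁅jordanGen k t, jordanGen k a⁆ ∈ adjoin k (jordanGen k '' S)) : Normalizes k S t := by
  rintro _ ⟨a, ha, rfl⟩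
  by_cases ha_zeta : a = zeta
  · subst ha_zeta
    exact (hzeta ha).elim (.of_lie_eq_smul (mem_adjoin ha))
  by_cases ha_gInv : a = gInv
  · subst ha_gInv
    exact .of_lie_inverse_mem g_mul_gInv gInv_mul_g (mem_adjoin ha) (h g hg nofun nofun)
  · exact .of_lie_mem (mem_adjoin ha) (h a ha ha_zeta ha_gInv)

theorem normalizes_gInv : Normalizes k {g} gInv := by
  simp [Normalizes, NormalizesAt.of_commute, commute_iff_eq, g_mul_gInv, gInv_mul_g]

theorem normalizes_x : Normalizes k {gInv, g} x :=
  normalizes_of_lie_mem (by simp) (by simp) (by simp [commute_x_g.lie_eq])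

theorem normalizes_u : Normalizes k {x, gInv, g} u :=
  normalizes_of_lie_mem (by simp) (by simp) (by simp [commute_u_x.lie_eq, commute_u_g.lie_eq])

theorem normalizes_zeta : Normalizes k {u, x, gInv, g} zeta :=
  normalizes_of_lie_mem (by simp) (by simp)
    (by simp [lie_zeta_u, lie_zeta_x, commute_zeta_g.lie_eq, mem_adjoin])

theorem normalizes_y : Normalizes k {zeta, u, x, gInv, g} y := by
  refine normalizes_of_lie_mem (by simp)
    (fun _ => ⟨-1, lie_y_zeta.trans (neg_one_smul k _).symm⟩) ?_
  have mem {a} (ha : a ∈ ({zeta, u, x, gInv, g} : Set JordanGen)) := mem_adjoin (k := k) ha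
  rintro _ (rfl | rfl | rfl | rfl | rfl) hzeta hgInv
  · exact absurd rfl hzeta
  · exact lie_y_u (k := k) ▸ sub_mem (mem (by simp)) (one_mem _)
  · exact lie_y_x (k := k) ▸ neg_mem (Subalgebra.smul_mem _ (pow_mem (mem (by simp)) 2) _)
  · exact absurd rfl hgInv
  · exact lie_y_g (k := k) ▸ neg_mem (mul_mem (mem (by simp)) (mem (by simp)))

theorem normalizes_v : Normalizes k {y, zeta, u, x, gInv, g} v := by
  refine normalizes_of_lie_mem (by simp) (fun _ => ⟨1, lie_v_zeta.trans (one_smul k _).symm⟩) ?_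
  have mem {a} (ha : a ∈ ({y, zeta, u, x, gInv, g} : Set JordanGen)) := mem_adjoin (k := k) ha
  rintro _ (rfl | rfl | rfl | rfl | rfl | rfl) hzeta hgInv
  · exact lie_v_y (k := k) ▸ sub_mem (mul_mem (mem (by simp)) (mem (by simp)))
      (mul_mem (mem (by simp)) (mem (by simp)))
  · exact absurd rfl hzeta
  · exact lie_v_u (k := k) ▸ neg_mem (Subalgebra.smul_mem _ (pow_mem (mem (by simp)) 2) _)
  · exact lie_v_x (k := k) ▸ add_mem (sub_mem (one_mem _) (mem (by simp)))
      (mul_mem (mem (by simp)) (mem (by simp)))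
  · exact absurd rfl hgInv
  · exact lie_v_g (k := k) ▸ mul_mem (mem (by simp)) (mem (by simp))

theorem adjoin_image_eq_top :
    adjoin k (jordanGen k '' {v, y, zeta, u, x, gInv, g}) = ⊤ := by
  rw [← adjoin_range_presentedGen (R := k) (r := JordanDoubleRel k), ← Set.image_univ]
  congr 2
  ext (_ | _ | _ | _ | _ | _ | _) <;> simp

theorem isNormalizingChain :
    IsNormalizingChain k (jordanGen k '' {v, y, zeta, u, x, gInv, g}) := by
  have insert {S t} (hS : IsNormalizingChain k (jordanGen k '' S)) (h : Normalizes k S t) :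
      IsNormalizingChain k (jordanGen k '' insert t S) := by
    rw [Set.image_insert_eq]
    exact hS.cons h
  have hg : IsNormalizingChain k (jordanGen k '' {g}) := by
    rw [← insert_empty_eq]
    exact insert (by simpa using .empty) (by simp [Normalizes])
  exact insert (insert (insert (insert (insert (insert hg normalizes_gInv) normalizes_x)
    normalizes_u) normalizes_zeta) normalizes_y) normalizes_v

end Chain

end jordanGen

end JordanDouble

section JordanCoordinates

open Algebra JordanGen

variable {k V : Type*} [Field k] [DivisionRing V] [Algebra k V]

/-- Elements `x`, `g`, `q`, `s` that commute with each other, and commuting elements `ζ`, `E` that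
act on them by the commutator as derivations: `ζ` is the Euler operator of `x`, and `E` is the one
for the weights `1`, `2`, `1`, `0` of `x`, `g`, `q`, `s`. In particular `s` and `g / q²` are central
in the skew field that these elements generate. -/
structure IsJordanCoordinates (x g q s ζ E : V) : Prop where
  x_ne_zero : x ≠ 0
  g_ne_zero : g ≠ 0
  commute_g_x : Commute g x
  commute_q_x : Commute q x
  commute_s_x : Commute s x
  commute_q_g : Commute q g
  commute_s_g : Commute s g
  commute_s_q : Commute s q
  lie_zeta_x : ⁅ζ, x⁆ = x
  commute_zeta_g : Commute ζ g
  commute_zeta_q : Commute ζ q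
  commute_zeta_s : Commute ζ s
  lie_E_x : ⁅E, x⁆ = x
  lie_E_g : ⁅E, g⁆ = 2 * g
  lie_E_q : ⁅E, q⁆ = q
  commute_E_s : Commute E s
  commute_E_zeta : Commute E ζ

/-- The images of the generators of the double of the Jordan plane in terms of coordinates. The
formulas come from solving the defining relations with `E = -2 x⁻¹ y` and `q = x u + 2 + 2 g`; then
`s` is the part of `q⁻¹ x v` that the relations leave undetermined. -/
noncomputable def jordanImage (k : Type*) {V : Type*} [Field k] [DivisionRing V] [Algebra k V]
    (x g q s ζ E : V) : JordanGen → V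
  | .x => x
  | .g => g
  | .gInv => g⁻¹
  | .zeta => ζ
  | .y => -((1 / 2 : k) • (x * E))
  | .u => x⁻¹ * (q - 2 - 2 * g)
  | .v => x⁻¹ * (q * s + 2 + 2 * g + ((1 / 2 : k) • q - 2 * g) * ζ +
      (1 / 2 : k) • ((q - 2 - 2 * g) * E))

namespace IsJordanCoordinates

variable {x g q s ζ E : V}

theorem lie_inv_x {a : V} (h : IsJordanCoordinates x g q s ζ E) (ha : ⁅a, x⁆ = x) :
    ⁅a, x⁻¹⁆ = -x⁻¹ := by
  rw [lie_inverse_eq (mul_inv_cancel₀ h.x_ne_zero) (inv_mul_cancel₀ h.x_ne_zero), ha,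
    inv_mul_cancel₀ h.x_ne_zero, one_mul]

theorem lift_jordanImage_eq [CharZero k] (h : IsJordanCoordinates x g q s ζ E)
    ⦃a b : FreeAlgebra k JordanGen⦄ (hab : JordanDoubleRel k a b) :
    FreeAlgebra.lift k (jordanImage k x g q s ζ E) a =
      FreeAlgebra.lift k (jordanImage k x g q s ζ E) b := by
  -- With an arbitrary right factor `d`, the commutation rules become a terminating rewrite system
  -- that also applies inside products.
  suffices ∀ d, FreeAlgebra.lift k (jordanImage k x g q s ζ E) a * d =
      FreeAlgebra.lift k (jordanImage k x g q s ζ E) b * d by simpa using this 1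
  intro d
  cases hab <;>
    simp only [map_mul, map_add, map_sub, map_smul, map_one, FreeAlgebra.lift_ι_apply, jordanImage,
      mul_inv_cancel₀ h.g_ne_zero, inv_mul_cancel₀ h.g_ne_zero, pow_two]
  all_goals
    simp only [mul_add, add_mul, mul_sub, sub_mul, mul_neg, neg_mul, mul_assoc, one_mul, two_mul,
      smul_mul_assoc, mul_smul_comm,
      mul_inv_cancel_left₀ h.x_ne_zero, inv_mul_cancel_left₀ h.x_ne_zero,
      h.commute_g_x.left_comm, h.commute_g_x.inv_right₀.left_comm,
      h.commute_q_x.left_comm, h.commute_q_x.inv_right₀.left_comm,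
      h.commute_s_x.left_comm, h.commute_s_x.inv_right₀.left_comm,
      h.commute_q_g.left_comm, h.commute_s_g.left_comm, h.commute_s_q.left_comm,
      mul_left_comm_of_lie_eq h.lie_zeta_x, mul_left_comm_of_lie_eq (h.lie_inv_x h.lie_zeta_x),
      h.commute_zeta_g.left_comm, h.commute_zeta_q.left_comm, h.commute_zeta_s.left_comm,
      mul_left_comm_of_lie_eq h.lie_E_x, mul_left_comm_of_lie_eq (h.lie_inv_x h.lie_E_x),
      mul_left_comm_of_lie_eq h.lie_E_g, mul_left_comm_of_lie_eq h.lie_E_q,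
      h.commute_E_s.left_comm, h.commute_E_zeta.left_comm]
  all_goals module

/-- The homomorphism from the double of the Jordan plane determined by coordinates. -/
noncomputable def toAlgHom (k : Type*) [Field k] [CharZero k] [Algebra k V]
    (h : IsJordanCoordinates x g q s ζ E) : JordanDouble k →ₐ[k] V :=
  presentedLift (jordanImage k x g q s ζ E) h.lift_jordanImage_eq

section Brackets

attribute [local instance] LieRing.ofAssociativeRing

theorem commute_jordanImage {c : V} (hx : Commute c x) (hg : Commute c g) (hq : Commute c q) :
    ∀ a ∈ ({u, .x, gInv, .g} : Set JordanGen), Commute c (jordanImage k x g q s ζ E a) := by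
  rintro _ (rfl | rfl | rfl | rfl)
  · exact hx.inv_right₀.mul_right ((hq.sub_right (.ofNat_right c 2)).sub_right
      ((Commute.ofNat_right c 2).mul_right hg))
  · exact hx
  · exact hg.inv_right₀
  · exact hg

theorem commute_jordanImage_y {c : V} (hx : Commute c x) (hE : Commute c E) :
    Commute c (jordanImage k x g q s ζ E y) :=
  ((hx.mul_right hE).smul_right _).neg_right

theorem lie_jordanImage_u {c : V} (hx : Commute c x) (hg : Commute c g) (hq : ⁅c, q⁆ = 1) :
    ⁅c, jordanImage k x g q s ζ E u⁆ = x⁻¹ := by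
  simp only [jordanImage, lie_mul_right, lie_sub, hx.inv_right₀.lie_eq, hg.lie_eq, hq,
    (Commute.ofNat_right c 2).lie_eq]
  simp

theorem lie_x_zeta (h : IsJordanCoordinates x g q s ζ E) : ⁅x, ζ⁆ = -x := by
  rw [← lie_skew, h.lie_zeta_x]

theorem lie_q_jordanImage_y (h : IsJordanCoordinates x g q s ζ E) :
    ⁅q, jordanImage k x g q s ζ E y⁆ = (1 / 2 : k) • (x * q) := by
  rw [jordanImage, lie_neg, lie_smul_right, lie_mul_right, h.commute_q_x.lie_eq, ← lie_skew,
    h.lie_E_q]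
  simp

theorem lie_jordanImage_v {c : V} (hx : Commute c x) (hg : Commute c g) (hq : Commute c q)
    (hzeta : Commute c ζ) (hE : Commute c E) (hs : ⁅c, s⁆ = 1) :
    ⁅c, jordanImage k x g q s ζ E v⁆ = x⁻¹ * q := by
  simp only [jordanImage, lie_mul_right, lie_sub, lie_add, lie_smul_right, hx.inv_right₀.lie_eq,
    hg.lie_eq, hq.lie_eq, hzeta.lie_eq, hE.lie_eq, hs, (Commute.ofNat_right c 2).lie_eq]
  simp

end Brackets

variable [CharZero k]

theorem toAlgHom_jordanGen (h : IsJordanCoordinates x g q s ζ E) (a : JordanGen) :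
    h.toAlgHom k (jordanGen k a) = jordanImage k x g q s ζ E a :=
  presentedLift_presentedGen _ _ _

theorem injectiveOnAdjoin_insert {S : Set JordanGen} {t : JordanGen} {c e : V}
    (h : IsJordanCoordinates x g q s ζ E)
    (hS : InjectiveOnAdjoin (h.toAlgHom k) (jordanGen k '' S)) (hn : jordanGen.Normalizes k S t)
    (hcS : ∀ a ∈ S, Commute c (jordanImage k x g q s ζ E a))
    (hct : ⁅c, jordanImage k x g q s ζ E t⁆ = e) (hce : Commute c e) (he : e ≠ 0) :
    InjectiveOnAdjoin (h.toAlgHom k) (jordanGen k '' insert t S) := by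
  rw [Set.image_insert_eq]
  refine hS.insert hn ?_ (by rwa [toAlgHom_jordanGen]) hce.lie_eq he.isUnit
  rintro _ ⟨a, ha, rfl⟩
  rw [toAlgHom_jordanGen, (hcS a ha).lie_eq]

/-- The elements `Dx`, `Dg`, `Dq`, `Ds` play the role of partial derivatives. Commutators with `Dg`,
`Dx`, `Dq`, `x`, `q`, `Ds`, in this order, detect the generators `g`, `x`, `u`, `ζ`, `y`, `v`. -/
theorem toAlgHom_injective (h : IsJordanCoordinates x g q s ζ E) {Dx Dg Dq Ds : V}
    (hgg : ⁅Dg, g⁆ = 1) (hxg : Commute Dx g) (hxx : ⁅Dx, x⁆ = 1)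
    (hqg : Commute Dq g) (hqx : Commute Dq x) (hqq : ⁅Dq, q⁆ = 1) (q_ne_zero : q ≠ 0)
    (hsg : Commute Ds g) (hsx : Commute Ds x) (hsq : Commute Ds q) (hszeta : Commute Ds ζ)
    (hsE : Commute Ds E) (hss : ⁅Ds, s⁆ = 1) : Function.Injective (h.toAlgHom k) := by
  have inj_g : InjectiveOnAdjoin (h.toAlgHom k) (jordanGen k '' {JordanGen.g}) := by
    rw [← insert_empty_eq]
    refine h.injectiveOnAdjoin_insert (c := Dg) (by simpa using .empty)
      (by simp [jordanGen.Normalizes]) (by simp) hgg (.one_right _) one_ne_zero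
  have inj_gInv : InjectiveOnAdjoin (h.toAlgHom k) (jordanGen k '' {gInv, JordanGen.g}) := by
    rw [Set.image_insert_eq]
    exact inj_g.insert_inverse jordanGen.normalizes_gInv (jordanGen.mem_adjoin rfl)
      jordanGen.g_mul_gInv jordanGen.gInv_mul_g
  have inj_x := h.injectiveOnAdjoin_insert inj_gInv jordanGen.normalizes_x (c := Dx)
    (by simp [jordanImage, hxg, hxg.inv_right₀]) hxx (.one_right _) one_ne_zero
  have inj_u := h.injectiveOnAdjoin_insert inj_x jordanGen.normalizes_u (c := Dq)
    (by simp [jordanImage, hqx, hqg, hqg.inv_right₀]) (lie_jordanImage_u hqx hqg hqq)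
    hqx.inv_right₀ (inv_ne_zero h.x_ne_zero)
  have inj_zeta := h.injectiveOnAdjoin_insert inj_u jordanGen.normalizes_zeta (c := x) (e := -x)
    (commute_jordanImage (.refl x) h.commute_g_x.symm h.commute_q_x.symm)
    h.lie_x_zeta (Commute.refl x).neg_right
    (neg_ne_zero.2 h.x_ne_zero)
  have inj_y := h.injectiveOnAdjoin_insert inj_zeta jordanGen.normalizes_y (c := q)
    (Set.forall_insert_of_forall (commute_jordanImage h.commute_q_x h.commute_q_g (.refl q))
      h.commute_zeta_q.symm)
    h.lie_q_jordanImage_y ((h.commute_q_x.mul_right (.refl q)).smul_right _)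
    (by simp [h.x_ne_zero, q_ne_zero])
  have inj_v := h.injectiveOnAdjoin_insert inj_y jordanGen.normalizes_v (c := Ds)
    (Set.forall_insert_of_forall (Set.forall_insert_of_forall (commute_jordanImage hsx hsg hsq)
      hszeta) (commute_jordanImage_y hsx hsE))
    (lie_jordanImage_v hsx hsg hsq hszeta hsE hss) (hsx.inv_right₀.mul_right hsq)
    (mul_ne_zero (inv_ne_zero h.x_ne_zero) q_ne_zero)
  exact inj_v.injective jordanGen.adjoin_image_eq_top

end IsJordanCoordinates

end JordanCoordinates

section SkewSubfields

open Algebra JordanGen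

variable {k V : Type*} [Field k] [DivisionRing V] [Algebra k V] {x g q s ζ E : V}

theorem skewAdjoin_range_jordanImage_le :
    skewAdjoin k (Set.range (jordanImage k x g q s ζ E)) ≤ skewAdjoin k {x, g, q, s, ζ, E} := by
  refine skewAdjoin_le ?_
  set F := skewAdjoin k {x, g, q, s, ζ, E}
  have mem {a : V} (ha : a ∈ ({x, g, q, s, ζ, E} : Set V)) : a ∈ F := subset_skewAdjoin ha
  have hx : x ∈ F := mem (by simp)
  have hg : g ∈ F := mem (by simp)
  have hq : q ∈ F := mem (by simp)
  have hζ : ζ ∈ F := mem (by simp)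
  have hE : E ∈ F := mem (by simp)
  have h2g : 2 * g ∈ F := mul_mem (ofNat_mem _ 2) hg
  have hxu : q - 2 - 2 * g ∈ F := sub_mem (sub_mem hq (ofNat_mem _ 2)) h2g
  rintro _ ⟨_ | _ | _ | _ | _ | _ | _, rfl⟩
  · exact mul_mem (inv_mem hx) hxu
  · exact mul_mem (inv_mem hx) (add_mem (add_mem (add_mem (add_mem
      (mul_mem hq (mem (by simp))) (ofNat_mem _ 2)) h2g)
      (mul_mem (sub_mem (smul_mem_skewAdjoin _ hq) h2g) hζ))
      (smul_mem_skewAdjoin _ (mul_mem hxu hE)))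
  · exact hζ
  · exact hg
  · exact inv_mem hg
  · exact hx
  · exact neg_mem (smul_mem_skewAdjoin _ (mul_mem hx hE))

theorem skewAdjoin_le_range_jordanImage [CharZero k] (x_ne_zero : x ≠ 0) (q_ne_zero : q ≠ 0) :
    skewAdjoin k {x, g, q, s, ζ, E} ≤ skewAdjoin k (Set.range (jordanImage k x g q s ζ E)) := by
  refine skewAdjoin_le ?_
  set F := skewAdjoin k (Set.range (jordanImage k x g q s ζ E))
  have mem (a : JordanGen) : jordanImage k x g q s ζ E a ∈ F := subset_skewAdjoin ⟨a, rfl⟩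
  have hx : x ∈ F := mem .x
  have hg : g ∈ F := mem .g
  have hζ : ζ ∈ F := mem zeta
  have h2g : 2 * g ∈ F := mul_mem (ofNat_mem _ 2) hg
  have hxu : q - 2 - 2 * g ∈ F := by
    simpa [jordanImage, x_ne_zero] using mul_mem hx (mem u)
  have hq : q ∈ F := by simpa using add_mem (add_mem hxu h2g) (ofNat_mem F 2)
  have hE : E ∈ F := by
    simpa [jordanImage, x_ne_zero] using smul_mem_skewAdjoin (-2 : k) (mul_mem (inv_mem hx) (mem y))
  have hqs : q * s ∈ F := by
    have hxv := mul_mem hx (mem v)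
    rwa [jordanImage, mul_inv_cancel_left₀ x_ne_zero,
      add_mem_cancel_right (smul_mem_skewAdjoin _ (mul_mem hxu hE)),
      add_mem_cancel_right (mul_mem (sub_mem (smul_mem_skewAdjoin _ hq) h2g) hζ),
      add_mem_cancel_right h2g, add_mem_cancel_right (ofNat_mem F 2)] at hxv
  have hs : s ∈ F := by simpa [q_ne_zero] using mul_mem (inv_mem hq) hqs
  rintro _ (rfl | rfl | rfl | rfl | rfl | rfl) <;> assumption

end SkewSubfields

section WeylCoordinates

open Algebra JordanGen

variable {k V : Type*} [Field k] [DivisionRing V] [Algebra k V] {P Q : Fin 2 ⊕ Fin 2 → V}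

namespace IsWeylSystem

section Brackets

attribute [local instance] LieRing.ofAssociativeRing

theorem isJordanCoordinates (h : IsWeylSystem P Q) :
    IsJordanCoordinates (Q (.inl 0)) (Q (.inl 1) ^ 2 * Q (.inr 0)) (Q (.inl 1)) (Q (.inr 1))
      (Q (.inl 0) * P (.inl 0)) (Q (.inl 0) * P (.inl 0) + Q (.inl 1) * P (.inl 1)) where
  x_ne_zero := h.q_ne_zero _
  g_ne_zero := mul_ne_zero (pow_ne_zero 2 (h.q_ne_zero _)) (h.q_ne_zero _)
  commute_g_x := ((h.commute_q _ _).pow_left 2).mul_left (h.commute_q _ _)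
  commute_q_x := h.commute_q _ _
  commute_s_x := h.commute_q _ _
  commute_q_g := ((h.commute_q _ _).pow_right 2).mul_right (h.commute_q _ _)
  commute_s_g := ((h.commute_q _ _).pow_right 2).mul_right (h.commute_q _ _)
  commute_s_q := h.commute_q _ _
  lie_zeta_x := by simp [lie_mul_left, h.lie_p_q]
  commute_zeta_g := by
    simp [commute_iff_lie_eq, pow_two, lie_mul_left, lie_mul_right, h.lie_p_q, h.lie_q_q]
  commute_zeta_q := by
    simp [commute_iff_lie_eq, lie_mul_left, h.lie_p_q, h.lie_q_q]
  commute_zeta_s := by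
    simp [commute_iff_lie_eq, lie_mul_left, h.lie_p_q, h.lie_q_q]
  lie_E_x := by simp [add_lie, lie_mul_left, h.lie_p_q, h.lie_q_q]
  lie_E_g := by
    simp [pow_two, add_lie, lie_mul_left, lie_mul_right, h.lie_p_q, h.lie_q_q, two_mul, mul_assoc]
  lie_E_q := by simp [add_lie, lie_mul_left, h.lie_p_q, h.lie_q_q]
  commute_E_s := by
    simp [commute_iff_lie_eq, add_lie, lie_mul_left, h.lie_p_q, h.lie_q_q]
  commute_E_zeta :=
    have hpq {i j : Fin 2} (hij : i ≠ j) := h.commute_of_ne (Sum.inl_injective.ne hij)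
    (Commute.refl _).add_left
      (((h.commute_q _ _).mul_right (hpq zero_ne_one).symm).mul_left
        ((hpq one_ne_zero).mul_right (h.commute_p _ _)))

theorem toAlgHom_injective [CharZero k] (h : IsWeylSystem P Q) :
    Function.Injective (h.isJordanCoordinates.toAlgHom k) := by
  have q_ne_zero := h.q_ne_zero
  refine h.isJordanCoordinates.toAlgHom_injective (q_ne_zero := q_ne_zero _)
    (Dx := P (.inl 0)) (Dg := (Q (.inl 1) ^ 2)⁻¹ * P (.inr 0))
    (Dq := P (.inl 1) - 2 * ((Q (.inl 1))⁻¹ * (Q (.inr 0) * P (.inr 0)))) (Ds := P (.inr 1))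
    ?_ ?_ ?_ ?_ ?_ ?_ ?_ ?_ ?_ ?_ ?_ ?_ <;>
  simp [commute_iff_lie_eq, pow_two, add_lie, sub_lie, lie_add, lie_mul_left, lie_mul_right,
    h.lie_p_q, h.lie_q_q, h.lie_p_p, h.lie_inv_q_q, q_ne_zero, mul_assoc, two_mul, mul_add]

end Brackets

theorem skewAdjoin_jordanCoordinates (h : IsWeylSystem P Q) :
    skewAdjoin k {Q (.inl 0), Q (.inl 1) ^ 2 * Q (.inr 0), Q (.inl 1), Q (.inr 1),
      Q (.inl 0) * P (.inl 0), Q (.inl 0) * P (.inl 0) + Q (.inl 1) * P (.inl 1)} =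
        skewAdjoin k (Set.range (P ∘ Sum.inl) ∪ Set.range Q) := by
  apply le_antisymm <;> refine skewAdjoin_le ?_
  · set F := skewAdjoin k (Set.range (P ∘ Sum.inl) ∪ Set.range Q)
    have hP (i : Fin 2) : P (.inl i) ∈ F := subset_skewAdjoin (.inl ⟨i, rfl⟩)
    have hQ (i) : Q i ∈ F := subset_skewAdjoin (.inr ⟨i, rfl⟩)
    rintro _ (rfl | rfl | rfl | rfl | rfl | rfl)
    · exact hQ _
    · exact mul_mem (pow_mem (hQ _) 2) (hQ _)
    · exact hQ _
    · exact hQ _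
    · exact mul_mem (hQ _) (hP _)
    · exact add_mem (mul_mem (hQ _) (hP _)) (mul_mem (hQ _) (hP _))
  · set S : Set V := {Q (.inl 0), _, _, _, _, _}
    have mem {a : V} (ha : a ∈ S) : a ∈ skewAdjoin k S := subset_skewAdjoin ha
    have hx := mem (a := Q (.inl 0)) (by simp [S])
    have hq := mem (a := Q (.inl 1)) (by simp [S])
    have hζ := mem (a := Q (.inl 0) * P (.inl 0)) (by simp [S])
    have q_ne_zero := h.q_ne_zero
    rintro _ (⟨i, rfl⟩ | ⟨i | i, rfl⟩) <;> fin_cases i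
    · simpa [q_ne_zero] using mul_mem (inv_mem hx) hζ
    · simpa [q_ne_zero] using mul_mem (inv_mem hq) (sub_mem
        (mem (a := Q (.inl 0) * P (.inl 0) + Q (.inl 1) * P (.inl 1)) (by simp [S])) hζ)
    · exact hx
    · exact hq
    · have hg := mem (a := Q (.inl 1) ^ 2 * Q (.inr 0)) (by simp [S])
      have hz := mul_mem (inv_mem (pow_mem hq 2)) hg
      rwa [inv_mul_cancel_left₀ (pow_ne_zero 2 (q_ne_zero _))] at hz
    · exact mem (by simp [S])

theorem closure_range_toAlgHom [CharZero k] (h : IsWeylSystem P Q) :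
    Subfield.closure (Set.range (h.isJordanCoordinates.toAlgHom k)) =
      skewAdjoin k (Set.range (P ∘ Sum.inl) ∪ Set.range Q) := by
  rw [closure_range_eq_skewAdjoin_image _ adjoin_range_presentedGen, ← Set.range_comp,
    ← h.skewAdjoin_jordanCoordinates,
    show _ ∘ _ = jordanImage k _ _ _ _ _ _ from funext h.isJordanCoordinates.toAlgHom_jordanGen]
  exact skewAdjoin_range_jordanImage_le.antisymm
    (skewAdjoin_le_range_jordanImage (h.q_ne_zero _) (h.q_ne_zero _))

end IsWeylSystem

end WeylCoordinates

theorem exists_isWeylSystem_sum (k : Type*) [Field k] [CharZero k] (m n : ℕ) :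
    ∃ P Q : Fin m ⊕ Fin n → SkewFrac (WeylAlgebra (m + n) k), IsWeylSystem P Q :=
  ⟨_, _, (isWeylSystem_presentedGen.map (toOreFrac k (WeylAlgebra (m + n) k))).comp
    finSumFinEquiv.injective⟩

instance isNoetherianDomain_jordanDouble (k : Type*) [Field k] [CharZero k] :
    IsNoetherianDomain (JordanDouble k) := by
  obtain ⟨P, Q, h⟩ := exists_isWeylSystem_sum k 2 2
  have := (h.toAlgHom_injective (k := k)).isDomain
  exact jordanGen.isNormalizingChain.isNoetherianDomain jordanGen.adjoin_image_eq_top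

theorem corollary4p10_general (k : Type*) [Field k] [CharZero k] :
    FracIsoWeylSkewField k (JordanDouble k) 2 2 ∧
      GelfandKirillovProperty k (JordanDouble k) := by
  obtain ⟨P, Q, h⟩ := exists_isWeylSystem_sum k 2 2
  obtain ⟨ψ, hψ, closure_ψ⟩ := exists_weylAlgHom_ratFunc (k := k) h
  have hfrac : FracIsoWeylSkewField k (JordanDouble k) 2 2 :=
    ⟨inferInstance, inferInstance, ⟨oreFracEquivOfClosureEq _ ψ h.toAlgHom_injective hψ
      (h.closure_range_toAlgHom.trans closure_ψ.symm)⟩⟩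
  exact ⟨hfrac, 2, 2, one_le_two, hfrac⟩

theorem corollary4p10 (k : Type*) [Field k] [IsAlgClosed k] [CharZero k] :
    FracIsoWeylSkewField k (JordanDouble k) 2 2 ∧
      GelfandKirillovProperty k (JordanDouble k) :=
  corollary4p10_general k
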